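/- Let $N\ge 2$, let $\Omega\subseteq S^{N-1}$ be a domain (a nonempty connected relatively open subset of the unit sphere of $\mathbb R^N$), let $V\in L^\infty(\Omega)$ be real-valued and let $\rho\ge 1$. Put $\mathcal C_\Omega^\rho=\{r\omega:\ \omega\in\Omega,\ r>\rho\}\subset\mathbb R^N$ and $C_H=\left(\frac{N-2}{2}\right)^2$. Let $\lambda_{V,1}$ be the principal Dirichlet eigenvalue of $-\Delta_\omega-V$ on $\Omega$, where $\Delta_\omega$ is the Laplace--Beltrami operator of $S^{N-1}$; that is, the real number for which there is $\phi\in H^1_0(\Omega)$ with $\phi>0$ a.e. in $\Omega$ and $\int_\Omega(\nabla_\omega\phi\cdot\nabla_\omega\eta-V\phi\eta)\,d\omega=\lambda_{V,1}\int_\Omega\phi\eta\,d\omega$ for all $\eta\in C_c^\infty(\Omega)$. For $v\in H^1_c(\mathcal C_\Omega^\rho)\cap L^\infty(\mathcal C_\Omega^\rho)$ (bounded $H^1$ functions whose support is a compact subset of the open set $\mathcal C_\Omega^\rho$) let $$\mathcal E_V(v,v)=\int_{\mathcal C_\Omega^\rho}\Big(|\nabla v|^2-\frac{V(x/|x|)}{|x|^2}v^2\Big)dx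 .$$ For $\mu,\epsilon\in\mathbb R$ consider the inequality $$\mathcal E_V(v,v)\ \ge\ \mu\int_{\mathcal C_\Omega^\rho}\frac{v^2}{|x|^2}\,dx+\epsilon\int_{\mathcal C_\Omega^\rho}\frac{v^2}{|x|^2\log^2|x|}\,dx\qquad\forall\,v\in H^1_c(\mathcal C_\Omega^\rho)\cap L^\infty(\mathcal C_\Omega^\rho).\tag{$*$}$$ Then $(*)$ holds with $\mu=C_H+\lambda_{V,1}$ and $\epsilon=\frac14$. Both constants are optimal in the sense that $(*)$ fails (i.e. is violated by some admissible $v$) in each of the following cases: (i) $\mu=C_H+\lambda_{V,1}$ and $\epsilon>\frac14$; (ii) $\mu>C_H+\lambda_{V,1}$ and $\epsilon\in\mathbb R$ arbitrary. -/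

import Mathlib

open MeasureTheory Filter Topology Set
open scoped ContDiff RealInnerProductSpace

/-- `ℝ^N` with its Euclidean norm. -/
abbrev RN (N : ℕ) : Type := EuclideanSpace ℝ (Fin N)

/-- The unit sphere `S^{N-1} ⊆ ℝ^N`. -/
abbrev USphere (N : ℕ) : Type := Metric.sphere (0 : RN N) 1

/-- The surface measure on `S^{N-1}`. -/
noncomputable def surfaceMeasure (N : ℕ) : Measure (USphere N) :=
  (volume : Measure (RN N)).toSphere

open Classical in
/-- The extension of a function `f` on `S^{N-1}` to `ℝ^N ∖ {0}` which is constant on rays,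
`x ↦ f (x / |x|)` (with the irrelevant value `0` at the origin). -/
noncomputable def angular {N : ℕ} (f : USphere N → ℝ) (x : RN N) : ℝ :=
  if hx : x = 0 then 0 else f ⟨‖x‖⁻¹ • x, by simp [norm_smul, hx]⟩

/-- The gradient `∇_ω f` on the round sphere, as a vector of `ℝ^N` tangent to the sphere:
the Euclidean gradient at the point of the extension of `f` which is constant on rays. -/
noncomputable def sphereGrad {N : ℕ} (f : USphere N → ℝ) (s : USphere N) : RN N :=
  gradient (angular f) (s : RN N)

/-- `f ∈ C_c^∞(Ω)` for an open `Ω ⊆ S^{N-1}`. A function on the sphere is smooth iff its extension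
constant on rays is smooth off the origin; closed subsets of the sphere are compact. -/
def IsSphereTest {N : ℕ} (Ω : Set (USphere N)) (f : USphere N → ℝ) : Prop :=
  ContDiffOn ℝ ∞ (angular f) {0}ᶜ ∧ tsupport f ⊆ Ω

/-- `f ∈ H^1_0(Ω)` with weak gradient `F`, for an open `Ω ⊆ S^{N-1}`: the pair `(f, F)` is a limit
in `L²(Ω)` of pairs `(ψ, ∇_ω ψ)` with `ψ ∈ C_c^∞(Ω)`. -/
structure IsSphereH10 {N : ℕ} (Ω : Set (USphere N)) (f : USphere N → ℝ) (F : USphere N → RN N) :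
    Prop where
  memLp : MemLp f 2 ((surfaceMeasure N).restrict Ω)
  memLp_grad : MemLp F 2 ((surfaceMeasure N).restrict Ω)
  exists_approx : ∃ ψ : ℕ → USphere N → ℝ, (∀ n, IsSphereTest Ω (ψ n)) ∧
    Tendsto (fun n => eLpNorm (fun s => ψ n s - f s) 2 ((surfaceMeasure N).restrict Ω))
      atTop (𝓝 0) ∧
    Tendsto (fun n => eLpNorm (fun s => sphereGrad (ψ n) s - F s) 2
      ((surfaceMeasure N).restrict Ω)) atTop (𝓝 0)

/-- `f`, with weak gradient `F`, is a (weak) Dirichlet eigenfunction of `-Δ_ω - V` in `Ω` with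
eigenvalue `l`, up to the requirement that it be nonzero. -/
def IsDirichletEigenfunction {N : ℕ} (Ω : Set (USphere N)) (V : USphere N → ℝ) (l : ℝ)
    (f : USphere N → ℝ) (F : USphere N → RN N) : Prop :=
  IsSphereH10 Ω f F ∧ ∀ η : USphere N → ℝ, IsSphereTest Ω η →
    ∫ s in Ω, (⟪F s, sphereGrad η s⟫ - V s * f s * η s) ∂(surfaceMeasure N) =
      l * ∫ s in Ω, f s * η s ∂(surfaceMeasure N)

/-- `l` is the principal Dirichlet eigenvalue of `-Δ_ω - V` in `Ω`: the eigenvalue that has a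
positive eigenfunction. -/
def IsPrincipalEigenvalue {N : ℕ} (Ω : Set (USphere N)) (V : USphere N → ℝ) (l : ℝ) : Prop :=
  ∃ (f : USphere N → ℝ) (F : USphere N → RN N), IsDirichletEigenfunction Ω V l f F ∧
    ∀ᵐ s ∂((surfaceMeasure N).restrict Ω), 0 < f s

/-- The cone-like domain `{rω : ω ∈ Ω, r > ρ}`. -/
def coneDomain {N : ℕ} (Ω : Set (USphere N)) (ρ : ℝ) : Set (RN N) :=
  {x | ∃ r : ℝ, ρ < r ∧ ∃ s ∈ Ω, x = r • (s : RN N)}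

/-- `v ∈ H^1_c(G) ∩ L^∞(G)` with weak gradient `g`, for an open `G ⊆ ℝ^N`. -/
structure IsH1cLinfty {N : ℕ} (G : Set (RN N)) (v : RN N → ℝ) (g : RN N → RN N) : Prop where
  memLp : MemLp v 2 (volume.restrict G)
  memLp_grad : MemLp g 2 (volume.restrict G)
  weak_grad : ∀ φ : RN N → ℝ, ContDiff ℝ ∞ φ → HasCompactSupport φ → tsupport φ ⊆ G →
    ∫ x in G, v x • gradient φ x = - ∫ x in G, φ x • g x
  memLp_top : MemLp v ⊤ (volume.restrict G)
  compact_support : ∃ K : Set (RN N), IsCompact K ∧ K ⊆ G ∧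
    ∀ᵐ x ∂(volume.restrict (G \ K)), v x = 0

/-- The quadratic form `∫ |∇v|² - V(ω)|x|⁻² v² dx` over the cone-like domain, where `g = ∇v`. -/
noncomputable def coneEnergy {N : ℕ} (Ω : Set (USphere N)) (V : USphere N → ℝ) (ρ : ℝ)
    (v : RN N → ℝ) (g : RN N → RN N) : ℝ :=
  ∫ x in coneDomain Ω ρ, (‖g x‖ ^ 2 - angular V x / ‖x‖ ^ 2 * v x ^ 2)

/-- The Hardy constant `C_H = ((N - 2) / 2)²`. -/
noncomputable def hardyConst (N : ℕ) : ℝ := (((N : ℝ) - 2) / 2) ^ 2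

/-- The improved Hardy inequality with constants `μ` and `ε` on the cone-like domain. -/
def ImprovedHardy {N : ℕ} (Ω : Set (USphere N)) (V : USphere N → ℝ) (ρ μ ε : ℝ) : Prop :=
  ∀ (v : RN N → ℝ) (g : RN N → RN N), IsH1cLinfty (coneDomain Ω ρ) v g →
    coneEnergy Ω V ρ v g ≥
      μ * (∫ x in coneDomain Ω ρ, v x ^ 2 / ‖x‖ ^ 2) +
      ε * ∫ x in coneDomain Ω ρ, v x ^ 2 / (‖x‖ ^ 2 * Real.log ‖x‖ ^ 2)

/-! In polar coordinates `x = rω` one has `dx = r^(N-1) dr dω` and `|∇v|² = (∂_r v)² + r⁻²|∇_ω v|²`,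
so the two halves of the gradient can be estimated independently. On each ray, the one-dimensional
weighted Hardy inequality with logarithmic remainder (`radial_hardy`) bounds the radial half from
below. It gives the constants `C_H` and `1/4`, and is proved by completing a square around the
ground state `r^(-(N-2)/2) (log r)^(1/2)`. On each sphere of radius `r > ρ`, the restriction of a
smooth compactly supported `v` is a test function in `Ω`. The angular half is then bounded through
the variational inequality `λ ∫ η² ≤ ∫ (|∇η|² - Vη²)` (`IsPrincipalEigenvalue.mul_integral_sq_le`).
The latter is Picone's argument: test the eigenvalue equation with `η²/φ` and discard a square. As
`φ` is only a positive `H¹_0` function, `η²/φ` is first replaced by a smooth regularisation. Adding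
the halves proves the inequality for smooth functions. Mollification
(`IsH1cLinfty.exists_smooth_approx`) extends it to bounded `H¹` functions with compact support.

For optimality, insert products `h(r)ψ(ω)` with `ψ` approximating the eigenfunction. What remains is
an inequality for `h` alone (`ImprovedHardy.radial_le`). The substitution `h(r) = r^(-(N-2)/2) f(log
r)` turns it into `(μ - C_H - λ) ∫ f² + ε ∫ f²/t² ≤ ∫ f'²` for all `f` supported in `(log ρ, ∞)`
(`ImprovedHardy.log_le`). If `μ > C_H + λ`, a wide bump far out violates this, because both its
Dirichlet energy and the `ε` term are small relative to `∫ f²`. If `μ = C_H + λ` and `ε > 1/4`, the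
substitution `f(t) = t^(1/2) g(log t)` reduces it to `(ε - 1/4) ∫ g² ≤ ∫ g'²`, which wide bumps
violate again. -/

/-! ### Polar coordinates -/

/-- The measure `r^(N-1) dr` on `(ρ, ∞)`. -/
noncomputable def radialMeasure (N : ℕ) (ρ : ℝ) : Measure ℝ :=
  (volume.restrict (Ioi ρ)).withDensity fun r => ENNReal.ofReal (r ^ (N - 1))

instance instSFiniteRadialMeasure (N : ℕ) (ρ : ℝ) : SFinite (radialMeasure N ρ) := by
  unfold radialMeasure; infer_instance

instance instIsFiniteMeasureSurfaceMeasure (N : ℕ) : IsFiniteMeasure (surfaceMeasure N) := by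
  unfold surfaceMeasure; infer_instance

instance instIsOpenPosMeasureSurfaceMeasure (N : ℕ) :
    (surfaceMeasure N).IsOpenPosMeasure := by
  unfold surfaceMeasure; infer_instance

/-- The product measure describing `coneDomain Ω ρ` in polar coordinates. -/
noncomputable def polarMeasure {N : ℕ} (Ω : Set (USphere N)) (ρ : ℝ) : Measure (USphere N × ℝ) :=
  ((surfaceMeasure N).restrict Ω).prod (radialMeasure N ρ)

/-- The polar coordinate map `(s, r) ↦ r s`. -/
noncomputable def polarMap {N : ℕ} (p : USphere N × ℝ) : RN N := p.2 • (p.1 : RN N)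

lemma continuous_polarMap {N : ℕ} : Continuous (polarMap (N := N)) := by
  unfold polarMap; fun_prop

lemma norm_smul_sphere {N : ℕ} {r : ℝ} (hr : 0 ≤ r) (s : USphere N) : ‖r • (s : RN N)‖ = r := by
  rw [norm_smul, norm_eq_of_mem_sphere, mul_one, Real.norm_of_nonneg hr]

lemma smul_sphere_ne_zero {N : ℕ} {r : ℝ} (hr : 0 < r) (s : USphere N) : r • (s : RN N) ≠ 0 := by
  rw [← norm_pos_iff, norm_smul_sphere hr.le]; exact hr

lemma smul_sphere_injective {N : ℕ} {r r' : ℝ} (hr : 0 < r) (hr' : 0 < r') {s s' : USphere N}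
    (h : r • (s : RN N) = r' • (s' : RN N)) : r = r' ∧ s = s' := by
  have h1 : r = r' := by
    rw [← norm_smul_sphere hr.le s, ← norm_smul_sphere hr'.le s', h]
  subst h1
  exact ⟨rfl, Subtype.ext (smul_right_injective _ hr.ne' h)⟩

lemma smul_mem_coneDomain {N : ℕ} {Ω : Set (USphere N)} {ρ r : ℝ} (hρ : 0 ≤ ρ) (hr : 0 < r)
    {s : USphere N} : r • (s : RN N) ∈ coneDomain Ω ρ ↔ s ∈ Ω ∧ ρ < r := by
  constructor
  · rintro ⟨r', hr', s', hs', h⟩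
    obtain ⟨rfl, rfl⟩ := smul_sphere_injective hr (hρ.trans_lt hr') h
    exact ⟨hs', hr'⟩
  · rintro ⟨hs, h⟩
    exact ⟨r, h, s, hs, rfl⟩

lemma lt_norm_of_mem_coneDomain {N : ℕ} {Ω : Set (USphere N)} {ρ : ℝ} (hρ : 0 ≤ ρ) {x : RN N}
    (hx : x ∈ coneDomain Ω ρ) : ρ < ‖x‖ := by
  obtain ⟨r, hr, s, -, rfl⟩ := hx
  rwa [norm_smul_sphere (hρ.trans hr.le)]

open scoped Pointwise in
lemma isOpen_coneDomain {N : ℕ} {Ω : Set (USphere N)} (hΩ : IsOpen Ω) {ρ : ℝ} (hρ : 0 ≤ ρ) :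
    IsOpen (coneDomain Ω ρ) := by
  have h := IsOpen.smul_sphere (E := RN N) one_ne_zero (isOpen_Ioi (a := ρ)) (by simpa using hρ) hΩ
  refine (?_ : coneDomain Ω ρ = Ioi ρ • (Subtype.val '' Ω)) ▸ h
  apply Set.ext
  intro x
  constructor
  · rintro ⟨r, hr, s, hs, rfl⟩
    exact ⟨r, hr, s, ⟨s, hs, rfl⟩, rfl⟩
  · rintro ⟨r, hr, _, ⟨s, hs, rfl⟩, rfl⟩
    exact ⟨r, hr, s, hs, rfl⟩

lemma map_volumeIoiPow (n : ℕ) :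
    (Measure.volumeIoiPow n).map Subtype.val =
      (volume.restrict (Ioi (0 : ℝ))).withDensity fun r => ENNReal.ofReal (r ^ n) := by
  have hme := MeasurableEmbedding.subtype_coe (measurableSet_Ioi (a := (0 : ℝ)))
  ext t ht
  rw [hme.map_apply, Measure.volumeIoiPow, withDensity_apply _ (measurable_subtype_coe ht),
    withDensity_apply _ ht, ← map_comap_subtype_coe measurableSet_Ioi,
    hme.restrict_map, hme.lintegral_map]

/-- Mathlib's polar decomposition lives on the subtypes `{0}ᶜ` and `Ioi 0`. Here it is transported
to a map on `USphere N × ℝ`. Removing the origin does not change Lebesgue measure, which is where `1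
≤ N` is needed. -/
lemma measurePreserving_polarMap_zero {N : ℕ} (hN : 1 ≤ N) :
    MeasurePreserving (polarMap (N := N)) ((surfaceMeasure N).prod (radialMeasure N 0))
      (volume : Measure (RN N)) := by
  refine ⟨continuous_polarMap.measurable, ?_⟩
  have : Nontrivial (RN N) := by
    have : Nonempty (Fin N) := ⟨⟨0, hN⟩⟩
    infer_instance
  have h0 := (volume : Measure (RN N)).measurePreserving_homeomorphUnitSphereProd
  have hfr : Module.finrank ℝ (RN N) - 1 = N - 1 := by simp
  rw [hfr] at h0
  have h1 := h0.symm (homeomorphUnitSphereProd (RN N)).toMeasurableEquiv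
  have h2 : radialMeasure N 0 = (Measure.volumeIoiPow (N - 1)).map Subtype.val :=
    (map_volumeIoiPow _).symm
  have h3 : (surfaceMeasure N).prod (radialMeasure N 0) =
      ((surfaceMeasure N).prod (Measure.volumeIoiPow (N - 1))).map
        (Prod.map id Subtype.val) := by
    rw [h2, ← Measure.map_prod_map _ _ measurable_id measurable_subtype_coe, Measure.map_id]
  rw [h3, Measure.map_map continuous_polarMap.measurable (by fun_prop)]
  have h4 : polarMap ∘ Prod.map id Subtype.val =
      Subtype.val ∘ (homeomorphUnitSphereProd (RN N)).symm := by
    ext p : 1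
    simp [polarMap]
  rw [h4, ← Measure.map_map measurable_subtype_coe
    (homeomorphUnitSphereProd (RN N)).symm.measurable]
  have h5 := h1.map_eq
  change Measure.map (homeomorphUnitSphereProd (RN N)).symm _ = _ at h5
  rw [surfaceMeasure, h5, map_comap_subtype_coe (measurableSet_singleton _).compl,
    restrict_compl_singleton]

lemma radialMeasure_restrict {N : ℕ} {ρ : ℝ} (hρ : 0 ≤ ρ) :
    (radialMeasure N 0).restrict (Ioi ρ) = radialMeasure N ρ := by
  rw [radialMeasure, restrict_withDensity measurableSet_Ioi,
    Measure.restrict_restrict measurableSet_Ioi, radialMeasure,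
    inter_eq_left.2 (Ioi_subset_Ioi hρ)]

lemma ae_radialMeasure_mem (N : ℕ) (ρ : ℝ) : ∀ᵐ r ∂(radialMeasure N ρ), ρ < r :=
  (withDensity_absolutelyContinuous _ _).ae_le (ae_restrict_mem measurableSet_Ioi)

lemma measurePreserving_polarMap {N : ℕ} (hN : 1 ≤ N) {Ω : Set (USphere N)} (hΩ : IsOpen Ω)
    {ρ : ℝ} (hρ : 0 ≤ ρ) :
    MeasurePreserving (polarMap (N := N)) (polarMeasure Ω ρ)
      (volume.restrict (coneDomain Ω ρ)) := by
  have h := (measurePreserving_polarMap_zero hN).restrict_preimage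
    (isOpen_coneDomain hΩ hρ).measurableSet
  convert h using 1
  rw [polarMeasure, ← radialMeasure_restrict hρ, Measure.prod_restrict]
  -- The preimage of the cone and `Ω ×ˢ Ioi ρ` can differ only at radii `r ≤ 0`, which
  -- `radialMeasure N 0` does not charge.
  apply Measure.restrict_congr_set
  have h0 : ∀ᵐ p ∂((surfaceMeasure N).prod (radialMeasure N 0)), 0 < p.2 :=
    Measure.quasiMeasurePreserving_snd.ae (ae_radialMeasure_mem N 0)
  filter_upwards [h0] with p hp
  exact propext ((smul_mem_coneDomain (ρ := ρ) (Ω := Ω) hρ hp).symm)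

lemma ae_polarMeasure_snd {N : ℕ} (Ω : Set (USphere N)) (ρ : ℝ) :
    ∀ᵐ p ∂(polarMeasure Ω ρ), ρ < p.2 :=
  Measure.quasiMeasurePreserving_snd.ae (ae_radialMeasure_mem N ρ)

lemma integral_coneDomain {N : ℕ} (hN : 1 ≤ N) {Ω : Set (USphere N)} (hΩ : IsOpen Ω)
    {ρ : ℝ} (hρ : 0 ≤ ρ) {f : RN N → ℝ}
    (hf : AEStronglyMeasurable f (volume.restrict (coneDomain Ω ρ))) :
    ∫ x in coneDomain Ω ρ, f x = ∫ p, f (polarMap p) ∂(polarMeasure Ω ρ) := by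
  have h := measurePreserving_polarMap hN hΩ hρ
  rw [← h.map_eq] at hf ⊢
  exact integral_map h.aemeasurable hf

lemma integral_radialMeasure (N : ℕ) {ρ : ℝ} (hρ : 0 ≤ ρ) (f : ℝ → ℝ) :
    ∫ r, f r ∂(radialMeasure N ρ) = ∫ r in Ioi ρ, r ^ (N - 1) * f r := by
  rw [radialMeasure, integral_withDensity_eq_integral_toReal_smul (by fun_prop) (by simp)]
  apply setIntegral_congr_fun measurableSet_Ioi
  intro r hr
  have : 0 < r := hρ.trans_lt hr
  simp only [smul_eq_mul]
  rw [ENNReal.toReal_ofReal (by positivity)]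

/-! ### Angular extensions and the spherical gradient -/

lemma angular_smul {N : ℕ} (f : USphere N → ℝ) {r : ℝ} (hr : 0 < r) (s : USphere N) :
    angular f (r • (s : RN N)) = f s := by
  rw [angular, dif_neg (smul_sphere_ne_zero hr s)]
  congr 1
  ext1
  simp only [norm_smul_sphere hr.le, smul_smul, inv_mul_cancel₀ hr.ne', one_smul]

lemma angular_coe {N : ℕ} (f : USphere N → ℝ) (s : USphere N) : angular f (s : RN N) = f s := by
  simpa using angular_smul f one_pos s

lemma sphere_ne_zero {N : ℕ} (s : USphere N) : (s : RN N) ≠ 0 := by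
  simpa using smul_sphere_ne_zero one_pos s

lemma exists_smul_sphere {N : ℕ} {x : RN N} (hx : x ≠ 0) :
    ∃ s : USphere N, x = ‖x‖ • (s : RN N) :=
  ⟨⟨‖x‖⁻¹ • x, by simp [norm_smul, hx]⟩, by simp [smul_smul, hx]⟩

lemma angular_of_ne {N : ℕ} (f : USphere N → ℝ) {x : RN N} (hx : x ≠ 0) :
    angular f x = f ⟨‖x‖⁻¹ • x, by simp [norm_smul, hx]⟩ := by
  rw [angular, dif_neg hx]

section Test

variable {N : ℕ} {Ω : Set (USphere N)} {η : USphere N → ℝ}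

lemma IsSphereTest.continuous (h : IsSphereTest Ω η) : Continuous η := by
  have h1 : Continuous fun s : USphere N => angular η (s : RN N) :=
    h.1.continuousOn.comp_continuous continuous_subtype_val fun s => sphere_ne_zero s
  simpa only [angular_coe] using h1

lemma IsSphereTest.contDiffAt (h : IsSphereTest Ω η) {x : RN N} (hx : x ≠ 0) :
    ContDiffAt ℝ ∞ (angular η) x :=
  h.1.contDiffAt (isOpen_compl_singleton.mem_nhds hx)

lemma IsSphereTest.differentiableAt (h : IsSphereTest Ω η) {x : RN N} (hx : x ≠ 0) :
    DifferentiableAt ℝ (angular η) x :=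
  (h.contDiffAt hx).differentiableAt (by simp)

lemma IsSphereTest.hasGradientAt (h : IsSphereTest Ω η) (s : USphere N) :
    HasGradientAt (angular η) (sphereGrad η s) (s : RN N) :=
  (h.differentiableAt (sphere_ne_zero s)).hasGradientAt

lemma IsSphereTest.continuous_grad (h : IsSphereTest Ω η) : Continuous (sphereGrad η) := by
  have h1 : ContinuousOn (fderiv ℝ (angular η)) {0}ᶜ :=
    h.1.continuousOn_fderiv_of_isOpen isOpen_compl_singleton (by simp)
  exact (InnerProductSpace.toDual ℝ (RN N)).symm.continuous.comp
    (h1.comp_continuous continuous_subtype_val fun s => sphere_ne_zero s)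

lemma IsSphereTest.bounded (h : IsSphereTest Ω η) : ∃ C, 0 ≤ C ∧ ∀ s, |η s| ≤ C := by
  obtain ⟨C, hC⟩ := isCompact_univ.exists_bound_of_continuousOn h.continuous.continuousOn
  exact ⟨max C 0, le_max_right _ _, fun s => (hC s (mem_univ s)).trans (le_max_left _ _)⟩

lemma IsSphereTest.bounded_grad (h : IsSphereTest Ω η) : ∃ C, 0 ≤ C ∧ ∀ s, ‖sphereGrad η s‖ ≤ C := by
  obtain ⟨C, hC⟩ := isCompact_univ.exists_bound_of_continuousOn h.continuous_grad.continuousOn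
  exact ⟨max C 0, le_max_right _ _, fun s => (hC s (mem_univ s)).trans (le_max_left _ _)⟩

lemma IsSphereTest.memLp (h : IsSphereTest Ω η) (p : ENNReal) :
    MemLp η p ((surfaceMeasure N).restrict Ω) := by
  obtain ⟨C, -, hC⟩ := h.bounded
  exact MemLp.of_bound h.continuous.aestronglyMeasurable C (.of_forall hC)

lemma IsSphereTest.memLp_grad (h : IsSphereTest Ω η) (p : ENNReal) :
    MemLp (sphereGrad η) p ((surfaceMeasure N).restrict Ω) := by
  obtain ⟨C, -, hC⟩ := h.bounded_grad
  exact MemLp.of_bound h.continuous_grad.aestronglyMeasurable C (.of_forall hC)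

end Test

/-! ### Radial and tangential components of the gradient -/

/-- The derivative of the radial projection composed with a function, on the sphere. -/
lemma hasGradientAt_angular_slice {N : ℕ} {v : RN N → ℝ} {r : ℝ} {s : USphere N}
    (hv : DifferentiableAt ℝ v (r • (s : RN N))) :
    HasGradientAt (angular fun s : USphere N => v (r • (s : RN N)))
      (r • (gradient v (r • (s : RN N)) - ⟪gradient v (r • (s : RN N)), (s : RN N)⟫ • (s : RN N)))
      (s : RN N) := by
  have hs0 := sphere_ne_zero s
  have hn : ‖(s : RN N)‖ = 1 := norm_eq_of_mem_sphere s
  have hev : (angular fun s : USphere N => v (r • (s : RN N))) =ᶠ[𝓝 (s : RN N)]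
      fun y => v (r • (‖y‖⁻¹ • y)) := by
    filter_upwards [isOpen_compl_singleton.mem_nhds hs0] with y hy
    rw [angular_of_ne _ hy]
  refine HasGradientAt.congr_of_eventuallyEq ?_ hev
  have hnorm : HasFDerivAt (fun y : RN N => ‖y‖) (innerSL ℝ (s : RN N)) (s : RN N) := by
    have := (hasStrictFDerivAt_norm_sq (s : RN N)).hasFDerivAt.sqrt (by simp [hn])
    simpa [Real.sqrt_sq, hn, ← ofNat_smul_eq_nsmul ℝ, smul_smul] using this
  have hinv := (hasDerivAt_inv (by simp [hn])).comp_hasFDerivAt (s : RN N) hnorm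
  have hg := ((hinv.smul (hasFDerivAt_id (s : RN N))).const_smul r)
  have hv' : HasFDerivAt v (fderiv ℝ v (r • (s : RN N)))
      (r • (‖(s : RN N)‖⁻¹ • (s : RN N))) := by
    simpa [hn] using hv.hasFDerivAt
  have hc := hv'.comp (s : RN N) hg
  rw [hasGradientAt_iff_hasFDerivAt]
  refine hc.congr_fderiv ?_
  ext y
  -- At a unit vector `s`, the derivative of `y ↦ y / |y|` is the projection `y - ⟪s, y⟫ s` onto the
  -- tangent space.
  have h1 : (fderiv ℝ v (r • (s : RN N))) (r • (-(⟪(s : RN N), y⟫) • (s : RN N) + y)) =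
      r * (⟪gradient v (r • (s : RN N)), y⟫
        - ⟪gradient v (r • (s : RN N)), (s : RN N)⟫ * ⟪(s : RN N), y⟫) := by
    rw [← inner_gradient_left, inner_smul_right, inner_add_right, inner_smul_right]
    ring
  rw [InnerProductSpace.toDual_apply_apply, real_inner_smul_left, inner_sub_left,
    real_inner_smul_left, ← h1]
  simp [hn, add_comm]

/-- Pythagoras: the spherical gradient of the slice is `r` times the component of `∇v` orthogonal to
`s`. -/
lemma norm_gradient_sq_polar {N : ℕ} {v : RN N → ℝ} {r : ℝ} (hr : 0 < r) {s : USphere N}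
    (hv : DifferentiableAt ℝ v (r • (s : RN N))) :
    ‖gradient v (r • (s : RN N))‖ ^ 2 = ⟪gradient v (r • (s : RN N)), (s : RN N)⟫ ^ 2 +
      ‖sphereGrad (fun s : USphere N => v (r • (s : RN N))) s‖ ^ 2 / r ^ 2 := by
  have hn : ‖(s : RN N)‖ = 1 := norm_eq_of_mem_sphere s
  rw [sphereGrad, (hasGradientAt_angular_slice hv).gradient, norm_smul, mul_pow, Real.norm_eq_abs,
    sq_abs, mul_div_cancel_left₀ _ (by positivity), norm_sub_sq_real, norm_smul, hn,
    inner_smul_right, Real.norm_eq_abs, mul_one, sq_abs]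
  ring

lemma hasDerivAt_ray {N : ℕ} {v : RN N → ℝ} {r : ℝ} {s : USphere N}
    (hv : DifferentiableAt ℝ v (r • (s : RN N))) :
    HasDerivAt (fun r : ℝ => v (r • (s : RN N))) ⟪gradient v (r • (s : RN N)), (s : RN N)⟫ r := by
  rw [inner_gradient_left]
  have h1 : HasDerivAt (fun r : ℝ => r • (s : RN N)) ((1 : ℝ) • (s : RN N)) r :=
    (hasDerivAt_id r).smul_const _
  rw [one_smul] at h1
  exact hv.hasFDerivAt.comp_hasDerivAt r h1

lemma isSphereTest_slice {N : ℕ} {Ω : Set (USphere N)} {ρ r : ℝ} (hρ : 0 ≤ ρ) (hr : 0 < r)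
    {v : RN N → ℝ} (hv : ContDiff ℝ ∞ v) (hs : tsupport v ⊆ coneDomain Ω ρ) :
    IsSphereTest Ω fun s : USphere N => v (r • (s : RN N)) := by
  constructor
  · have h1 : ContDiffOn ℝ ∞ (fun y : RN N => v (r • (‖y‖⁻¹ • y))) {0}ᶜ := by
      have h2 : ContDiffOn ℝ ∞ (fun y : RN N => ‖y‖⁻¹) {0}ᶜ :=
        (contDiffOn_id.norm ℝ fun x hx => hx).inv fun x hx => norm_ne_zero_iff.2 hx
      exact hv.comp_contDiffOn ((h2.smul contDiffOn_id).const_smul r)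
    exact h1.congr fun y hy => angular_of_ne _ hy
  · have h2 : tsupport (fun s : USphere N => v (r • (s : RN N))) ⊆
        (fun s : USphere N => r • (s : RN N)) ⁻¹' tsupport v := by
      apply closure_minimal
      · intro s hs
        exact subset_tsupport v hs
      · exact (isClosed_tsupport v).preimage (by fun_prop)
    intro s h
    exact ((smul_mem_coneDomain hρ hr).1 (hs (h2 h))).1

/-- Products of the square of a test function with a smooth function of another one. -/
lemma IsSphereTest.sq_mul_comp {N : ℕ} {Ω : Set (USphere N)} {η ψ : USphere N → ℝ}
    (hη : IsSphereTest Ω η) (hψ : IsSphereTest Ω ψ) {p : ℝ → ℝ} (hp : ContDiff ℝ ∞ p) :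
    IsSphereTest Ω (fun s => η s ^ 2 * p (ψ s)) ∧
    ∀ s, sphereGrad (fun s => η s ^ 2 * p (ψ s)) s =
      (2 * η s * p (ψ s)) • sphereGrad η s + (η s ^ 2 * deriv p (ψ s)) • sphereGrad ψ s := by
  have hang : ∀ y ∈ ({0}ᶜ : Set (RN N)), angular (fun s => η s ^ 2 * p (ψ s)) y =
      angular η y ^ 2 * p (angular ψ y) := by
    intro y hy
    simp only [angular_of_ne _ (show y ≠ 0 from hy)]
  refine ⟨⟨((hη.1.pow 2).mul (hp.comp_contDiffOn hψ.1)).congr hang, ?_⟩, fun s => ?_⟩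
  · refine (closure_mono ?_).trans hη.2
    -- The support condition comes from the factor `η²` alone; `p` need not vanish at `0`.
    intro s hs h0
    exact hs (by simp [h0])
  · have hs0 := sphere_ne_zero s
    have h1 := (hη.hasGradientAt s).hasFDerivAt
    have h2 := (hψ.hasGradientAt s).hasFDerivAt
    have h3 := ((hp.differentiable (by simp)) (angular ψ (s : RN N))).hasDerivAt.comp_hasFDerivAt
      (s : RN N) h2
    have h4 := (h1.pow 2).mul h3
    have hev : angular (fun s => η s ^ 2 * p (ψ s)) =ᶠ[𝓝 (s : RN N)]
        fun y => angular η y ^ 2 * p (angular ψ y) := by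
      filter_upwards [isOpen_compl_singleton.mem_nhds hs0] with y hy using hang y hy
    refine HasGradientAt.gradient (HasGradientAt.congr_of_eventuallyEq ?_ hev)
    rw [hasGradientAt_iff_hasFDerivAt]
    refine h4.congr_fderiv ?_
    ext y
    simp [angular_coe]
    ring

lemma IsSphereTest.sphereGrad_const_mul {N : ℕ} {Ω : Set (USphere N)} {ψ : USphere N → ℝ}
    (hψ : IsSphereTest Ω ψ) (c : ℝ) (s : USphere N) :
    sphereGrad (fun s => c * ψ s) s = c • sphereGrad ψ s := by
  have h2 := (hψ.hasGradientAt s).hasFDerivAt.const_mul c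
  have hev : angular (fun s => c * ψ s) = fun y => c * angular ψ y := by
    ext y
    by_cases hy : y = 0
    · simp [angular, hy]
    · simp only [angular_of_ne _ hy]
  refine HasGradientAt.gradient ?_
  rw [hasGradientAt_iff_hasFDerivAt, hev]
  refine h2.congr_fderiv ?_
  ext y
  simp

/-! ### Convergence of integrals of products -/

section L2

variable {α E : Type*} [MeasurableSpace α] {μ : Measure α} [NormedAddCommGroup E]
  [InnerProductSpace ℝ E]

lemma integrable_inner_of_memLp {A B : α → E} (hA : MemLp A 2 μ) (hB : MemLp B 2 μ) :
    Integrable (fun x => ⟪A x, B x⟫) μ :=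
  (MemLp.integrable_mul hA.norm hB.norm).mono' (hA.1.inner hB.1)
    (.of_forall fun _ => norm_inner_le_norm _ _)

/-- These integrals are inner products in `L²`, and the inner product is jointly continuous. -/
lemma tendsto_integral_inner_of_eLpNorm {A B : α → E} {a b : ℕ → α → E}
    (hA : MemLp A 2 μ) (hB : MemLp B 2 μ) (ha : ∀ n, MemLp (a n) 2 μ) (hb : ∀ n, MemLp (b n) 2 μ)
    (haA : Tendsto (fun n => eLpNorm (fun x => a n x - A x) 2 μ) atTop (𝓝 0))
    (hbB : Tendsto (fun n => eLpNorm (fun x => b n x - B x) 2 μ) atTop (𝓝 0)) :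
    Tendsto (fun n => ∫ x, ⟪a n x, b n x⟫ ∂μ) atTop (𝓝 (∫ x, ⟪A x, B x⟫ ∂μ)) := by
  have h1 : Tendsto (fun n => (ha n).toLp (a n)) atTop (𝓝 (hA.toLp A)) :=
    (Lp.tendsto_Lp_iff_tendsto_eLpNorm'' _ _ _ _).2 haA
  have h2 : Tendsto (fun n => (hb n).toLp (b n)) atTop (𝓝 (hB.toLp B)) :=
    (Lp.tendsto_Lp_iff_tendsto_eLpNorm'' _ _ _ _).2 hbB
  have h3 := Filter.Tendsto.inner (𝕜 := ℝ) h1 h2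
  have key : ∀ {f g : α → E} (hf : MemLp f 2 μ) (hg : MemLp g 2 μ),
      (inner ℝ (hf.toLp f) (hg.toLp g) : ℝ) = ∫ x, ⟪f x, g x⟫ ∂μ := by
    intro f g hf hg
    rw [L2.inner_def]
    apply integral_congr_ae
    filter_upwards [hf.coeFn_toLp, hg.coeFn_toLp] with x h1 h2
    rw [h1, h2]
  simpa only [key] using h3

lemma tendsto_eLpNorm_mul_of_memLp_top {V f : α → ℝ} {ψ : ℕ → α → ℝ} (hV : MemLp V ⊤ μ)
    (hf : AEStronglyMeasurable f μ) (hψ : ∀ n, AEStronglyMeasurable (ψ n) μ)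
    (h : Tendsto (fun n => eLpNorm (fun x => ψ n x - f x) 2 μ) atTop (𝓝 0)) :
    Tendsto (fun n => eLpNorm (fun x => V x * ψ n x - V x * f x) 2 μ) atTop (𝓝 0) := by
  have h1 : Tendsto (fun n => eLpNorm V ⊤ μ * eLpNorm (fun x => ψ n x - f x) 2 μ) atTop (𝓝 0) := by
    simpa using ENNReal.Tendsto.const_mul h (Or.inr hV.2.ne)
  refine tendsto_of_tendsto_of_tendsto_of_le_of_le tendsto_const_nhds h1 (fun n => zero_le) ?_
  intro n
  have h2 := eLpNorm_le_eLpNorm_top_mul_eLpNorm (μ := μ) 2 V ((hψ n).sub hf) (fun a b => a * b) 1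
    (.of_forall fun x => by simp)
  simp only [Pi.sub_apply, mul_sub, ENNReal.coe_one, one_mul] at h2
  exact h2

/-- Convergence of integrals of `c n * ⟪F, G n⟫` when `c n` is bounded and converges a.e. and
`G n → F` in `L²`. -/
lemma tendsto_integral_mul_inner {F : α → E} {G : ℕ → α → E} {c : ℕ → α → ℝ} {c' : α → ℝ} {C : ℝ}
    (hF : MemLp F 2 μ) (hG : ∀ n, MemLp (G n) 2 μ)
    (hGF : Tendsto (fun n => eLpNorm (fun x => G n x - F x) 2 μ) atTop (𝓝 0))
    (hcm : ∀ n, AEStronglyMeasurable (c n) μ) (hcb : ∀ n x, |c n x| ≤ C)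
    (hc : ∀ᵐ x ∂μ, Tendsto (fun n => c n x) atTop (𝓝 (c' x))) :
    Tendsto (fun n => ∫ x, c n x * ⟪F x, G n x⟫ ∂μ) atTop (𝓝 (∫ x, c' x * ‖F x‖ ^ 2 ∂μ)) := by
  have hFsq : Integrable (fun x => ‖F x‖ ^ 2) μ := hF.integrable_norm_pow (by simp)
  -- Split `⟪F, G n⟫ = ‖F‖² + ⟪F, G n - F⟫`. Dominated convergence handles the first term,
  -- Cauchy–Schwarz and the bound on `c n` the second.
  have h1 : Tendsto (fun n => ∫ x, c n x * ‖F x‖ ^ 2 ∂μ) atTop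
      (𝓝 (∫ x, c' x * ‖F x‖ ^ 2 ∂μ)) := by
    refine tendsto_integral_of_dominated_convergence (fun x => C * ‖F x‖ ^ 2)
      (fun n => (hcm n).mul hFsq.1) (hFsq.const_mul C) ?_ ?_
    · intro n
      filter_upwards with x
      rw [norm_mul, Real.norm_eq_abs, Real.norm_of_nonneg (by positivity)]
      exact mul_le_mul_of_nonneg_right (hcb n x) (by positivity)
    · filter_upwards [hc] with x hx using hx.mul_const _
  have hGFm : ∀ n, MemLp (fun x => G n x - F x) 2 μ := fun n => (hG n).sub hF
  have h2 : Tendsto (fun n => ∫ x, ‖F x‖ * ‖G n x - F x‖ ∂μ) atTop (𝓝 0) := by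
    have := tendsto_integral_inner_of_eLpNorm (E := ℝ) (A := fun x => ‖F x‖) (B := fun _ => 0)
      (a := fun _ x => ‖F x‖) (b := fun n x => ‖G n x - F x‖) hF.norm MemLp.zero'
      (fun _ => hF.norm) (fun n => (hGFm n).norm) (by simp)
      (by simpa [eLpNorm_norm] using hGF)
    simpa [mul_comm] using this
  have h3 : Tendsto (fun n => ∫ x, c n x * ⟪F x, G n x - F x⟫ ∂μ) atTop (𝓝 0) := by
    have h4 : Tendsto (fun n => C * ∫ x, ‖F x‖ * ‖G n x - F x‖ ∂μ) atTop (𝓝 0) := by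
      simpa using h2.const_mul C
    refine squeeze_zero_norm (fun n => ?_) h4
    rw [← integral_const_mul]
    refine norm_integral_le_of_norm_le ?_ ?_
    · exact (MemLp.integrable_mul hF.norm (hGFm n).norm).const_mul C
    · filter_upwards with x
      rw [norm_mul, Real.norm_eq_abs]
      exact mul_le_mul (hcb n x) (norm_inner_le_norm _ _) (norm_nonneg _)
        ((abs_nonneg _).trans (hcb n x))
  have h5 := h1.add h3
  rw [add_zero] at h5
  refine h5.congr fun n => ?_
  rw [← integral_add]
  · congr 1
    ext x
    rw [inner_sub_right, real_inner_self_eq_norm_sq]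
    ring
  · exact hFsq.bdd_mul (hcm n) (.of_forall (hcb n))
  · exact (integrable_inner_of_memLp hF (hGFm n)).bdd_mul (hcm n) (.of_forall (hcb n))

end L2

/-! ### The quadratic form on the sphere -/

section Sphere

variable {N : ℕ} {Ω : Set (USphere N)} {V : USphere N → ℝ} {lam : ℝ}

/-- The Dirichlet form of `-Δ - V` on `Ω`, at a test function. -/
noncomputable def sphereForm {N : ℕ} (Ω : Set (USphere N)) (V : USphere N → ℝ)
    (η : USphere N → ℝ) : ℝ :=
  ∫ s in Ω, (‖sphereGrad η s‖ ^ 2 - V s * η s ^ 2) ∂(surfaceMeasure N)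

lemma IsSphereTest.integrable_sq {η : USphere N → ℝ} (h : IsSphereTest Ω η) :
    Integrable (fun s => η s ^ 2) ((surfaceMeasure N).restrict Ω) := by
  simpa using (h.memLp 2).integrable_norm_pow (by simp)

lemma IsSphereTest.integrable_grad_sq {η : USphere N → ℝ} (h : IsSphereTest Ω η) :
    Integrable (fun s => ‖sphereGrad η s‖ ^ 2) ((surfaceMeasure N).restrict Ω) :=
  (h.memLp_grad 2).integrable_norm_pow (by simp)

lemma IsSphereTest.integrable_potential {η : USphere N → ℝ} (h : IsSphereTest Ω η)
    (hV : MemLp V ⊤ ((surfaceMeasure N).restrict Ω)) :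
    Integrable (fun s => V s * η s ^ 2) ((surfaceMeasure N).restrict Ω) :=
  h.integrable_sq.mul_of_top_right hV

/-- A positive eigenfunction can be approximated by test functions with convergence of the
quadratic forms. -/
lemma IsPrincipalEigenvalue.exists_approx (h : IsPrincipalEigenvalue Ω V lam) (hΩ : IsOpen Ω)
    (hΩn : Ω.Nonempty) (hV : MemLp V ⊤ ((surfaceMeasure N).restrict Ω)) :
    ∃ (ψ : ℕ → USphere N → ℝ) (Q : ℝ), 0 < Q ∧ (∀ n, IsSphereTest Ω (ψ n)) ∧
      Tendsto (fun n => ∫ s in Ω, ψ n s ^ 2 ∂(surfaceMeasure N)) atTop (𝓝 Q) ∧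
      Tendsto (fun n => sphereForm Ω V (ψ n)) atTop (𝓝 (lam * Q)) := by
  obtain ⟨f, F, ⟨⟨hf, hF, ψ, hψ, hψf, hψF⟩, heq⟩, hpos⟩ := h
  have hVf : MemLp (fun s => V s * f s) 2 ((surfaceMeasure N).restrict Ω) := hf.mul hV
  have hVψ : ∀ n, MemLp (fun s => V s * ψ n s) 2 ((surfaceMeasure N).restrict Ω) :=
    fun n => ((hψ n).memLp 2).mul hV
  have hVψf := tendsto_eLpNorm_mul_of_memLp_top hV hf.1 (fun n => ((hψ n).memLp 2).1) hψf
  have t1 := tendsto_integral_inner_of_eLpNorm hf hf (fun n => (hψ n).memLp 2)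
    (fun n => (hψ n).memLp 2) hψf hψf
  have t1' := tendsto_integral_inner_of_eLpNorm hf hf (fun n => hf)
    (fun n => (hψ n).memLp 2) (by simp) hψf
  have t2 := tendsto_integral_inner_of_eLpNorm hVf hf hVψ (fun n => (hψ n).memLp 2) hVψf hψf
  have t2' := tendsto_integral_inner_of_eLpNorm hVf hf (fun n => hVf)
    (fun n => (hψ n).memLp 2) (by simp) hψf
  have t3 := tendsto_integral_inner_of_eLpNorm hF hF (fun n => (hψ n).memLp_grad 2)
    (fun n => (hψ n).memLp_grad 2) hψF hψF
  have t3' := tendsto_integral_inner_of_eLpNorm hF hF (fun n => hF)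
    (fun n => (hψ n).memLp_grad 2) (by simp) hψF
  have i2 : ∀ n, Integrable (fun s => V s * f s * ψ n s) ((surfaceMeasure N).restrict Ω) :=
    fun n => MemLp.integrable_mul hVf ((hψ n).memLp 2)
  have e : ∀ n, ∫ s in Ω, ⟪F s, sphereGrad (ψ n) s⟫ ∂(surfaceMeasure N) -
      ∫ s in Ω, V s * f s * ψ n s ∂(surfaceMeasure N) =
      lam * ∫ s in Ω, f s * ψ n s ∂(surfaceMeasure N) := by
    intro n
    rw [← heq _ (hψ n), integral_sub (integrable_inner_of_memLp hF ((hψ n).memLp_grad 2)) (i2 n)]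
  have hin : ∀ a b : ℝ, ⟪a, b⟫ = a * b := fun a b => mul_comm _ _
  simp only [hin] at t1 t1' t2 t2'
  simp only [real_inner_self_eq_norm_sq] at t3 t3'
  -- By density the eigenfunction may be used as its own test function.
  have lim : ∫ s in Ω, ‖F s‖ ^ 2 ∂(surfaceMeasure N) -
      ∫ s in Ω, V s * f s * f s ∂(surfaceMeasure N) =
      lam * ∫ s in Ω, f s * f s ∂(surfaceMeasure N) :=
    tendsto_nhds_unique ((t3'.sub t2').congr e) (t1'.const_mul lam)
  refine ⟨ψ, ∫ s in Ω, f s * f s ∂(surfaceMeasure N), ?_, hψ, ?_, ?_⟩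
  · rw [integral_pos_iff_support_of_nonneg (fun s => mul_self_nonneg _)
      (MemLp.integrable_mul hf hf)]
    -- `f > 0` almost everywhere on `Ω`, and a nonempty open set has positive surface measure, so `∫
    -- f² > 0`.
    have h0 : 0 < ((surfaceMeasure N).restrict Ω) univ := by
      rw [Measure.restrict_apply_univ]
      exact hΩ.measure_pos _ hΩn
    refine h0.trans_le (measure_mono_ae ?_)
    filter_upwards [hpos] with s hs _
    exact mul_ne_zero hs.ne' hs.ne'
  · simpa only [sq] using t1
  · rw [← lim]
    refine (t3.sub t2).congr fun n => ?_
    rw [sphereForm, integral_sub (hψ n).integrable_grad_sq ((hψ n).integrable_potential hV)]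
    simp only [sq, mul_assoc]

/-! ### Picone's inequality and the variational bound for the principal eigenvalue -/

/-- The regularised reciprocals `1 / (δ + √(t² + κ²))`. -/
lemma regularised_inv {δ κ : ℝ} (hδ : 0 < δ) (hκ : 0 < κ) :
    ContDiff ℝ ∞ (fun t : ℝ => (δ + √(t ^ 2 + κ ^ 2))⁻¹) ∧
    (∀ t, |(δ + √(t ^ 2 + κ ^ 2))⁻¹| ≤ δ⁻¹) ∧
    (∀ t, deriv (fun t : ℝ => (δ + √(t ^ 2 + κ ^ 2))⁻¹) t =
      -(t / √(t ^ 2 + κ ^ 2)) / (δ + √(t ^ 2 + κ ^ 2)) ^ 2) ∧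
    (∀ t, |-(t / √(t ^ 2 + κ ^ 2)) / (δ + √(t ^ 2 + κ ^ 2)) ^ 2| ≤ (δ ^ 2)⁻¹) := by
  have hpos : ∀ t : ℝ, 0 < t ^ 2 + κ ^ 2 := fun t => by positivity
  have hden : ∀ t : ℝ, 0 < δ + √(t ^ 2 + κ ^ 2) := fun t => by positivity
  have hδle : ∀ t : ℝ, δ ≤ δ + √(t ^ 2 + κ ^ 2) := fun t =>
    le_add_of_nonneg_right (Real.sqrt_nonneg _)
  refine ⟨?_, fun t => ?_, fun t => ?_, fun t => ?_⟩
  · refine ContDiff.inv (contDiff_const.add (ContDiff.sqrt ?_ fun t => (hpos t).ne'))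
      fun t => (hden t).ne'
    fun_prop
  · rw [abs_of_pos (inv_pos.2 (hden t))]
    exact inv_anti₀ hδ (hδle t)
  · have h1 : HasDerivAt (fun t : ℝ => t ^ 2 + κ ^ 2) (2 * t) t := by
      simpa using (hasDerivAt_pow 2 t).add_const (κ ^ 2)
    have h2 := ((h1.sqrt (hpos t).ne').const_add δ).fun_inv (hden t).ne'
    rw [h2.deriv]
    congr 2
    rw [mul_div_mul_left _ _ two_ne_zero]
  · have hs : 0 < √(t ^ 2 + κ ^ 2) := Real.sqrt_pos.2 (hpos t)
    have h1 : |t| ≤ √(t ^ 2 + κ ^ 2) := Real.abs_le_sqrt (by nlinarith [sq_nonneg κ])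
    rw [abs_div, abs_neg, abs_div, abs_of_pos hs, abs_of_pos (pow_pos (hden t) 2), ← one_div]
    refine div_le_div₀ zero_le_one ((div_le_one hs).2 h1) (by positivity) ?_
    exact pow_le_pow_left₀ hδ.le (hδle t) 2

/-- Smooth approximants of a positive function may take negative values, so the reciprocal is built
from a smoothed `|t|`. Since `√(x² + κ²) → |t| = t`, the limits are nevertheless `1/(δ + t)` and its
derivative. -/
lemma tendsto_regularised_inv {δ t : ℝ} (hδ : 0 < δ) (ht : 0 < t) {x κ : ℕ → ℝ}
    (hx : Tendsto x atTop (𝓝 t)) (hκ : Tendsto κ atTop (𝓝 0)) :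
    Tendsto (fun n => (δ + √(x n ^ 2 + κ n ^ 2))⁻¹) atTop (𝓝 (δ + t)⁻¹) ∧
    Tendsto (fun n => -(x n / √(x n ^ 2 + κ n ^ 2)) / (δ + √(x n ^ 2 + κ n ^ 2)) ^ 2) atTop
      (𝓝 (-((δ + t) ^ 2)⁻¹)) := by
  have h1 : Tendsto (fun n => √(x n ^ 2 + κ n ^ 2)) atTop (𝓝 t) := by
    have := ((hx.pow 2).add (hκ.pow 2)).sqrt
    simpa [Real.sqrt_sq ht.le] using this
  have h2 : Tendsto (fun n => δ + √(x n ^ 2 + κ n ^ 2)) atTop (𝓝 (δ + t)) := h1.const_add δ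
  have h3 : δ + t ≠ 0 := by positivity
  refine ⟨h2.inv₀ h3, ?_⟩
  have := ((hx.div h1 ht.ne').neg).div (h2.pow 2) (pow_ne_zero 2 h3)
  rwa [div_self ht.ne', neg_div, one_div] at this

/-- The Picone-type inequality obtained by testing the equation with `η² / (δ + f)`. -/
lemma IsDirichletEigenfunction.picone_le {f : USphere N → ℝ} {F : USphere N → RN N}
    (h : IsDirichletEigenfunction Ω V lam f F)
    (hpos : ∀ᵐ s ∂((surfaceMeasure N).restrict Ω), 0 < f s)
    (hV : MemLp V ⊤ ((surfaceMeasure N).restrict Ω)) {η : USphere N → ℝ} (hη : IsSphereTest Ω η)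
    {δ : ℝ} (hδ : 0 < δ) :
    ∫ s in Ω, (V s + lam) * η s ^ 2 * (f s * (δ + f s)⁻¹) ∂(surfaceMeasure N) ≤
      ∫ s in Ω, ‖sphereGrad η s‖ ^ 2 ∂(surfaceMeasure N) := by
  obtain ⟨⟨hf, hF, ψ₀, hψ₀, hψf₀, hψF₀⟩, heq⟩ := h
  -- `L²` convergence gives almost everywhere convergence along a subsequence, as the nonlinear
  -- expressions in `ψ n` require.
  obtain ⟨k, hk, hae⟩ := (tendstoInMeasure_of_tendsto_eLpNorm (by simp)
    (fun n => ((hψ₀ n).memLp 2).1) hf.1 hψf₀).exists_seq_tendsto_ae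
  set ψ : ℕ → USphere N → ℝ := fun n => ψ₀ (k n) with hψdef
  have hψ : ∀ n, IsSphereTest Ω (ψ n) := fun n => hψ₀ (k n)
  have hψF : Tendsto (fun n => eLpNorm (fun s => sphereGrad (ψ n) s - F s) 2
      ((surfaceMeasure N).restrict Ω)) atTop (𝓝 0) := hψF₀.comp hk.tendsto_atTop
  have hκ : ∀ n : ℕ, (0 : ℝ) < 1 / ((n : ℝ) + 1) := fun n => by positivity
  have hκ0 : Tendsto (fun n : ℕ => 1 / ((n : ℝ) + 1)) atTop (𝓝 0) :=
    tendsto_one_div_add_atTop_nhds_zero_nat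
  set p : ℕ → ℝ → ℝ := fun n t => (δ + √(t ^ 2 + (1 / ((n : ℝ) + 1)) ^ 2))⁻¹ with hp
  have hreg := fun n => regularised_inv hδ (hκ n)
  have hpc : ∀ n, ContDiff ℝ ∞ (p n) := fun n => (hreg n).1
  have hpb : ∀ n t, |p n t| ≤ δ⁻¹ := fun n => (hreg n).2.1
  have hp'c : ∀ n, Continuous (deriv (p n)) := fun n => (hpc n).continuous_deriv (by simp)
  have hp'b : ∀ n t, |deriv (p n) t| ≤ (δ ^ 2)⁻¹ := by
    intro n t
    rw [hp, (hreg n).2.2.1 t]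
    exact (hreg n).2.2.2 t
  have hplim : ∀ᵐ s ∂((surfaceMeasure N).restrict Ω),
      Tendsto (fun n => p n (ψ n s)) atTop (𝓝 (δ + f s)⁻¹) := by
    filter_upwards [hpos, hae] with s hs1 hs2
    exact (tendsto_regularised_inv hδ hs1 hs2 hκ0).1
  have hp'lim : ∀ᵐ s ∂((surfaceMeasure N).restrict Ω),
      Tendsto (fun n => deriv (p n) (ψ n s)) atTop (𝓝 (-((δ + f s) ^ 2)⁻¹)) := by
    filter_upwards [hpos, hae] with s hs1 hs2
    refine (tendsto_regularised_inv hδ hs1 hs2 hκ0).2.congr fun n => ?_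
    rw [hp, (hreg n).2.2.1]
  obtain ⟨C, hC0, hC⟩ := hη.bounded
  have hηm := hη.continuous
  have hcomp : ∀ n, Continuous fun s => p n (ψ n s) :=
    fun n => (hpc n).continuous.comp (hψ n).continuous
  have hcomp' : ∀ n, Continuous fun s => deriv (p n) (ψ n s) :=
    fun n => (hp'c n).comp (hψ n).continuous
  have hiF : Integrable (fun s => ⟪F s, sphereGrad η s⟫) ((surfaceMeasure N).restrict Ω) :=
    integrable_inner_of_memLp hF (hη.memLp_grad 2)
  have hif : Integrable f ((surfaceMeasure N).restrict Ω) := hf.integrable (by norm_num)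
  have hiV : Integrable (fun s => (V s + lam) * f s) ((surfaceMeasure N).restrict Ω) :=
    hif.mul_of_top_right (hV.add (memLp_const lam))
  have b1 : ∀ n s, ‖2 * η s * p n (ψ n s)‖ ≤ 2 * C * δ⁻¹ := by
    intro n s
    rw [norm_mul, norm_mul]
    have := mul_le_mul (mul_le_mul_of_nonneg_left (hC s) (zero_le_two (α := ℝ))) (hpb n (ψ n s))
      (abs_nonneg _) (by positivity)
    simpa using this
  have b2 : ∀ n s, |η s ^ 2 * deriv (p n) (ψ n s)| ≤ C ^ 2 * (δ ^ 2)⁻¹ := by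
    intro n s
    rw [abs_mul, abs_pow]
    exact mul_le_mul (pow_le_pow_left₀ (abs_nonneg _) (hC s) 2) (hp'b _ _) (abs_nonneg _)
      (by positivity)
  have b3 : ∀ n s, ‖η s ^ 2 * p n (ψ n s)‖ ≤ C ^ 2 * δ⁻¹ := by
    intro n s
    rw [Real.norm_eq_abs, abs_mul, abs_pow]
    exact mul_le_mul (pow_le_pow_left₀ (abs_nonneg _) (hC s) 2) (hpb _ _) (abs_nonneg _)
      (by positivity)
  have m1 : ∀ n, Continuous fun s => 2 * η s * p n (ψ n s) := fun n =>
    (continuous_const.mul hηm).mul (hcomp n)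
  have m2 : ∀ n, Continuous fun s => η s ^ 2 * deriv (p n) (ψ n s) := fun n =>
    (hηm.pow 2).mul (hcomp' n)
  have m3 : ∀ n, Continuous fun s => η s ^ 2 * p n (ψ n s) := fun n =>
    (hηm.pow 2).mul (hcomp n)
  have i1 : ∀ n, Integrable (fun s => 2 * η s * p n (ψ n s) * ⟪F s, sphereGrad η s⟫)
      ((surfaceMeasure N).restrict Ω) := fun n =>
    hiF.bdd_mul (m1 n).aestronglyMeasurable (.of_forall (b1 n))
  have i2 : ∀ n, Integrable (fun s => η s ^ 2 * deriv (p n) (ψ n s) * ⟪F s, sphereGrad (ψ n) s⟫)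
      ((surfaceMeasure N).restrict Ω) := fun n =>
    (integrable_inner_of_memLp hF ((hψ n).memLp_grad 2)).bdd_mul (m2 n).aestronglyMeasurable
      (.of_forall (b2 n))
  have i3 : ∀ n, Integrable (fun s => η s ^ 2 * p n (ψ n s) * ((V s + lam) * f s))
      ((surfaceMeasure N).restrict Ω) := fun n =>
    hiV.bdd_mul (m3 n).aestronglyMeasurable (.of_forall (b3 n))
  -- This is the eigenvalue equation tested with the smooth function `η² p_n(ψ_n)`, an approximation
  -- of `η² / (δ + f)`.
  have e : ∀ n, ∫ s in Ω, 2 * η s * p n (ψ n s) * ⟪F s, sphereGrad η s⟫ ∂(surfaceMeasure N) +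
      ∫ s in Ω, η s ^ 2 * deriv (p n) (ψ n s) * ⟪F s, sphereGrad (ψ n) s⟫ ∂(surfaceMeasure N) =
      ∫ s in Ω, η s ^ 2 * p n (ψ n s) * ((V s + lam) * f s) ∂(surfaceMeasure N) := by
    intro n
    obtain ⟨t1, t2⟩ := hη.sq_mul_comp (hψ n) (hpc n)
    have h1 := heq _ t1
    have i4 : Integrable (fun s => η s ^ 2 * p n (ψ n s) * (V s * f s))
      ((surfaceMeasure N).restrict Ω) :=
        (hif.mul_of_top_right hV).bdd_mul (m3 n).aestronglyMeasurable (.of_forall (b3 n))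
    have i5 : Integrable (fun s => η s ^ 2 * p n (ψ n s) * f s)
      ((surfaceMeasure N).restrict Ω) :=
        hif.bdd_mul (m3 n).aestronglyMeasurable (.of_forall (b3 n))
    have h2 : ∀ s, ⟪F s, sphereGrad (fun s => η s ^ 2 * p n (ψ n s)) s⟫ -
        V s * f s * (η s ^ 2 * p n (ψ n s)) =
        2 * η s * p n (ψ n s) * ⟪F s, sphereGrad η s⟫ +
        η s ^ 2 * deriv (p n) (ψ n s) * ⟪F s, sphereGrad (ψ n) s⟫ -
        η s ^ 2 * p n (ψ n s) * (V s * f s) := by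
      intro s
      rw [t2, inner_add_right, real_inner_smul_right, real_inner_smul_right]
      ring
    simp only [h2] at h1
    have i12 : Integrable (fun s => 2 * η s * p n (ψ n s) * ⟪F s, sphereGrad η s⟫ +
        η s ^ 2 * deriv (p n) (ψ n s) * ⟪F s, sphereGrad (ψ n) s⟫)
        ((surfaceMeasure N).restrict Ω) := (i1 n).add (i2 n)
    rw [integral_sub i12 i4, integral_add (i1 n) (i2 n)] at h1
    rw [sub_eq_iff_eq_add] at h1
    rw [h1, ← integral_const_mul, ← integral_add _ i4]
    · congr 1
      ext s
      ring
    · exact (i5.const_mul lam).congr (.of_forall fun s => by simp only; ring)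
  have L1 : Tendsto (fun n => ∫ s in Ω, 2 * η s * p n (ψ n s) * ⟪F s, sphereGrad η s⟫
      ∂(surfaceMeasure N)) atTop (𝓝 (∫ s in Ω, 2 * η s * (δ + f s)⁻¹ * ⟪F s, sphereGrad η s⟫
      ∂(surfaceMeasure N))) := by
    refine tendsto_integral_of_dominated_convergence
      (fun s => 2 * C * δ⁻¹ * ‖⟪F s, sphereGrad η s⟫‖) (fun n => (i1 n).1)
      (hiF.norm.const_mul _) ?_ ?_
    · intro n
      filter_upwards with s
      rw [norm_mul]
      exact mul_le_mul_of_nonneg_right (b1 n s) (norm_nonneg _)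
    · filter_upwards [hplim] with s hs
      exact (hs.const_mul _).mul_const _
  have L2 : Tendsto (fun n => ∫ s in Ω, η s ^ 2 * deriv (p n) (ψ n s) *
      ⟪F s, sphereGrad (ψ n) s⟫ ∂(surfaceMeasure N)) atTop
      (𝓝 (∫ s in Ω, η s ^ 2 * (-((δ + f s) ^ 2)⁻¹) * ‖F s‖ ^ 2 ∂(surfaceMeasure N))) := by
    refine tendsto_integral_mul_inner hF (fun n => (hψ n).memLp_grad 2) hψF
      (fun n => (m2 n).aestronglyMeasurable) b2 ?_
    filter_upwards [hp'lim] with s hs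
    exact hs.const_mul _
  have L3 : Tendsto (fun n => ∫ s in Ω, η s ^ 2 * p n (ψ n s) * ((V s + lam) * f s)
      ∂(surfaceMeasure N)) atTop (𝓝 (∫ s in Ω, η s ^ 2 * (δ + f s)⁻¹ * ((V s + lam) * f s)
      ∂(surfaceMeasure N))) := by
    refine tendsto_integral_of_dominated_convergence
      (fun s => C ^ 2 * δ⁻¹ * ‖(V s + lam) * f s‖) (fun n => (i3 n).1)
      (hiV.norm.const_mul _) ?_ ?_
    · intro n
      filter_upwards with s
      rw [norm_mul]
      exact mul_le_mul_of_nonneg_right (b3 n s) (norm_nonneg _)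
    · filter_upwards [hplim] with s hs
      exact (hs.const_mul _).mul_const _
  have lim := tendsto_nhds_unique ((L1.add L2).congr e) L3
  have hfm := hf.1
  have hdm : AEStronglyMeasurable (fun s => (δ + f s)⁻¹) ((surfaceMeasure N).restrict Ω) :=
    (aestronglyMeasurable_const.add hfm).inv₀
  have hinvb : ∀ᵐ s ∂((surfaceMeasure N).restrict Ω), |(δ + f s)⁻¹| ≤ δ⁻¹ := by
    filter_upwards [hpos] with s hs
    rw [abs_of_pos (by positivity)]
    exact inv_anti₀ hδ (by linarith)
  have j1 : Integrable (fun s => 2 * η s * (δ + f s)⁻¹ * ⟪F s, sphereGrad η s⟫)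
      ((surfaceMeasure N).restrict Ω) := by
    refine hiF.bdd_mul (c := 2 * C * δ⁻¹)
      (((hηm.const_mul 2).aestronglyMeasurable).mul hdm) ?_
    filter_upwards [hinvb] with s hs
    rw [norm_mul, norm_mul]
    have := mul_le_mul (mul_le_mul_of_nonneg_left (hC s) (zero_le_two (α := ℝ))) hs
      (abs_nonneg _) (by positivity)
    simpa using this
  have j2 : Integrable (fun s => η s ^ 2 * (-((δ + f s) ^ 2)⁻¹) * ‖F s‖ ^ 2)
      ((surfaceMeasure N).restrict Ω) := by
    have hm : AEStronglyMeasurable (fun s => η s ^ 2 * (-((δ + f s) ^ 2)⁻¹))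
        ((surfaceMeasure N).restrict Ω) :=
      ((hηm.pow 2).aestronglyMeasurable).mul (((aestronglyMeasurable_const.add hfm).pow 2).inv₀.neg)
    refine Integrable.bdd_mul (c := C ^ 2 * (δ⁻¹) ^ 2) (hF.integrable_norm_pow (by simp)) hm ?_
    filter_upwards [hinvb] with s hs
    rw [Real.norm_eq_abs, abs_mul, abs_neg, ← inv_pow, abs_pow, abs_pow]
    exact mul_le_mul (pow_le_pow_left₀ (abs_nonneg _) (hC s) 2)
      (pow_le_pow_left₀ (abs_nonneg _) hs 2) (by positivity) (by positivity)
  have lhs : ∫ s in Ω, (V s + lam) * η s ^ 2 * (f s * (δ + f s)⁻¹) ∂(surfaceMeasure N) =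
      ∫ s in Ω, η s ^ 2 * (δ + f s)⁻¹ * ((V s + lam) * f s) ∂(surfaceMeasure N) := by
    congr 1
    ext s
    ring
  rw [lhs, ← lim, ← integral_add j1 j2]
  refine integral_mono (j1.add j2) hη.integrable_grad_sq fun s => ?_
  -- Picone's pointwise inequality: expanding this square bounds the limiting integrand by `|∇η|²`.
  have h1 : 0 ≤ ‖sphereGrad η s - (η s * (δ + f s)⁻¹) • F s‖ ^ 2 := by positivity
  rw [norm_sub_sq_real, real_inner_smul_right, norm_smul, mul_pow, Real.norm_eq_abs, sq_abs,
    real_inner_comm] at h1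
  rw [← inv_pow]
  nlinarith

/-- The variational inequality for the principal eigenvalue. -/
lemma IsPrincipalEigenvalue.mul_integral_sq_le (h : IsPrincipalEigenvalue Ω V lam)
    (hV : MemLp V ⊤ ((surfaceMeasure N).restrict Ω)) {η : USphere N → ℝ} (hη : IsSphereTest Ω η) :
    lam * ∫ s in Ω, η s ^ 2 ∂(surfaceMeasure N) ≤ sphereForm Ω V η := by
  obtain ⟨f, F, hfF, hpos⟩ := h
  have hfm := hfF.1.memLp.1
  have hi : Integrable (fun s => (V s + lam) * η s ^ 2) ((surfaceMeasure N).restrict Ω) :=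
    hη.integrable_sq.mul_of_top_right (hV.add (memLp_const lam))
  -- Let `δ → 0`: the quotient `f / (δ + f)` stays below `1` and tends to `1` wherever `f > 0`.
  have L : Tendsto (fun n : ℕ => ∫ s in Ω, (V s + lam) * η s ^ 2 *
      (f s * (1 / ((n : ℝ) + 1) + f s)⁻¹) ∂(surfaceMeasure N)) atTop
      (𝓝 (∫ s in Ω, (V s + lam) * η s ^ 2 ∂(surfaceMeasure N))) := by
    refine tendsto_integral_of_dominated_convergence (fun s => ‖(V s + lam) * η s ^ 2‖)
      (fun n => hi.1.mul (hfm.mul (aestronglyMeasurable_const.add hfm).inv₀)) hi.norm ?_ ?_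
    · intro n
      filter_upwards [hpos] with s hs
      rw [norm_mul]
      refine mul_le_of_le_one_right (norm_nonneg _) ?_
      have : (0 : ℝ) < 1 / ((n : ℝ) + 1) := by positivity
      rw [Real.norm_of_nonneg (by positivity), ← div_eq_mul_inv, div_le_one (by positivity)]
      linarith
    · filter_upwards [hpos] with s hs
      have h1 : Tendsto (fun n : ℕ => 1 / ((n : ℝ) + 1) + f s) atTop (𝓝 (0 + f s)) :=
        tendsto_one_div_add_atTop_nhds_zero_nat.add_const _
      rw [zero_add] at h1
      have h2 := ((h1.inv₀ hs.ne').const_mul (f s)).const_mul ((V s + lam) * η s ^ 2)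
      rwa [mul_inv_cancel₀ hs.ne', mul_one] at h2
  have h1 := le_of_tendsto' L fun n => hfF.picone_le hpos hV hη (by positivity)
  have h2 : ∫ s in Ω, (V s + lam) * η s ^ 2 ∂(surfaceMeasure N) =
      ∫ s in Ω, V s * η s ^ 2 ∂(surfaceMeasure N) +
      lam * ∫ s in Ω, η s ^ 2 ∂(surfaceMeasure N) := by
    rw [← integral_const_mul, ← integral_add (hη.integrable_potential hV)
      (hη.integrable_sq.const_mul lam)]
    congr 1
    ext s
    ring
  rw [sphereForm, integral_sub hη.integrable_grad_sq (hη.integrable_potential hV)]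
  linarith

end Sphere

/-! ### The one-dimensional inequality -/

lemma integral_deriv_of_hasCompactSupport {w : ℝ → ℝ} (hw : ContDiff ℝ 1 w)
    (hc : HasCompactSupport w) : ∫ r, deriv w r = 0 := by
  exact integral_eq_zero_of_hasDerivAt_of_integrable
    (fun x => (hw.differentiable (by simp) x).hasDerivAt)
    ((hw.continuous_deriv le_rfl).integrable_of_hasCompactSupport hc.deriv)
    (hw.continuous.integrable_of_hasCompactSupport hc)

lemma contDiff_of_forall_mem_tsupport {E : Type*} [NormedAddCommGroup E] [NormedSpace ℝ E]
    {f : E → ℝ} {n : WithTop ℕ∞} (h : ∀ x ∈ tsupport f, ContDiffAt ℝ n f x) : ContDiff ℝ n f := by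
  rw [contDiff_iff_contDiffAt]
  intro x
  by_cases hx : x ∈ tsupport f
  · exact h x hx
  · exact contDiffAt_const.congr_of_eventuallyEq (notMem_tsupport_iff_eventuallyEq.1 hx)

/-- Continuity has to be checked only on the support of the product, which lies in `U`. This serves
weights that are singular outside `U`. -/
lemma continuous_mul_of_tsupport_subset {X : Type*} [TopologicalSpace X] {u w : X → ℝ} {U : Set X}
    (hU : IsOpen U) (hu : Continuous u) (hs : tsupport u ⊆ U) (hw : ContinuousOn w U) :
    Continuous fun x => w x * u x := by
  refine continuous_of_tsupport fun x hx => ?_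
  have hx' : x ∈ U := hs (closure_mono (Function.support_mul_subset_right _ _) hx)
  exact (hw.continuousAt (hU.mem_nhds hx')).mul hu.continuousAt

/-- The one-dimensional Hardy inequality with logarithmic remainder. -/
lemma radial_hardy {N : ℕ} (hN : 2 ≤ N) {ρ : ℝ} (hρ : 1 ≤ ρ) {u : ℝ → ℝ} (hu : ContDiff ℝ 1 u)
    (hc : HasCompactSupport u) (hs : tsupport u ⊆ Ioi ρ) :
    ∫ r, (hardyConst N * (1 / r ^ 2 * u r ^ 2) +
      1 / 4 * (1 / (r ^ 2 * Real.log r ^ 2) * u r ^ 2)) ∂(radialMeasure N ρ) ≤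
    ∫ r, deriv u r ^ 2 ∂(radialMeasure N ρ) := by
  rw [integral_radialMeasure N (by linarith), integral_radialMeasure N (by linarith)]
  obtain ⟨n, rfl⟩ : ∃ n, N = n + 2 := ⟨N - 2, by omega⟩
  have hn : n + 2 - 1 = n + 1 := by omega
  rw [hn]
  -- `b r / r` is the logarithmic derivative of the ground state `r^(-n/2) (log r)^(1/2)`. The
  -- identity `expand` below says that `r^(n+1) (u' - (b/r) u)²` is the difference of the two
  -- integrands minus `w'`, and `w'` integrates to zero.
  set b : ℝ → ℝ := fun r => -(n / 2 : ℝ) + 1 / (2 * Real.log r) with hb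
  set w : ℝ → ℝ := fun r => b r * r ^ n * u r ^ 2 with hw
  have hlog : ∀ r ∈ Ioi ρ, 0 < Real.log r := fun r hr => Real.log_pos (hρ.trans_lt hr)
  have hpos : ∀ r ∈ Ioi ρ, 0 < r := fun r hr => by have := mem_Ioi.1 hr; linarith
  have hbd : ∀ r ∈ Ioi ρ, ContDiffAt ℝ 1 b r := by
    intro r hr
    refine contDiffAt_const.add (contDiffAt_const.div ?_ (by have := hlog r hr; positivity))
    exact contDiffAt_const.mul (Real.contDiffAt_log.2 (hpos r hr).ne')
  have hts : tsupport w ⊆ tsupport u := by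
    refine closure_mono fun r hr h0 => hr ?_
    simp [hw, h0]
  have hwc : ContDiff ℝ 1 w := by
    refine contDiff_of_forall_mem_tsupport fun r hr => ?_
    have hr' := hs (hts hr)
    exact ((hbd r hr').mul (contDiff_id.contDiffAt.pow n)).mul (hu.contDiffAt.pow 2)
  have hwsupp : HasCompactSupport w := hc.of_isClosed_subset (isClosed_tsupport _) hts
  have hzero : ∫ r in Ioi ρ, deriv w r = 0 := by
    rw [setIntegral_eq_integral_of_forall_compl_eq_zero,
      integral_deriv_of_hasCompactSupport hwc hwsupp]
    intro r hr
    exact image_eq_zero_of_notMem_tsupport fun h => hr (hs (hts (tsupport_deriv_subset h)))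
  have hcont : Continuous fun r => (r ^ (n + 1) * (hardyConst (n + 2) * (1 / r ^ 2) +
      1 / 4 * (1 / (r ^ 2 * Real.log r ^ 2))) * u r) * u r := by
    refine (continuous_mul_of_tsupport_subset isOpen_Ioi hu.continuous hs ?_).mul hu.continuous
    have h1 : ContinuousOn Real.log (Ioi ρ) :=
      Real.continuousOn_log.mono fun r hr => (hpos r hr).ne'
    have h2 : ∀ r ∈ Ioi ρ, r ^ 2 ≠ 0 := fun r hr => by have := hpos r hr; positivity
    have h3 : ∀ r ∈ Ioi ρ, r ^ 2 * Real.log r ^ 2 ≠ 0 := fun r hr => by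
      have := hpos r hr; have := hlog r hr; positivity
    fun_prop (disch := assumption)
  have i1 : Integrable (fun r => r ^ (n + 1) * (hardyConst (n + 2) * (1 / r ^ 2 * u r ^ 2) +
      1 / 4 * (1 / (r ^ 2 * Real.log r ^ 2) * u r ^ 2))) := by
    refine (hcont.integrable_of_hasCompactSupport hc.mul_left).congr (.of_forall fun r => ?_)
    ring
  have i2 : Integrable (fun r => r ^ (n + 1) * deriv u r ^ 2) := by
    have h1 := hu.continuous_deriv le_rfl
    have h2 : Continuous fun r => (r ^ (n + 1) * deriv u r) * deriv u r := by fun_prop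
    refine (h2.integrable_of_hasCompactSupport hc.deriv.mul_left).congr (.of_forall fun r => ?_)
    ring
  have i3 : Integrable (deriv w) :=
    (hwc.continuous_deriv le_rfl).integrable_of_hasCompactSupport hwsupp.deriv
  have key : ∫ r in Ioi ρ, (r ^ (n + 1) * (hardyConst (n + 2) * (1 / r ^ 2 * u r ^ 2) +
      1 / 4 * (1 / (r ^ 2 * Real.log r ^ 2) * u r ^ 2)) + deriv w r) ≤
      ∫ r in Ioi ρ, r ^ (n + 1) * deriv u r ^ 2 := by
    refine setIntegral_mono_on (i1.add i3).integrableOn i2.integrableOn measurableSet_Ioi ?_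
    intro r hr
    have hr0 := hpos r hr
    have hl := hlog r hr
    have d1 : HasDerivAt b (-(1 / (2 * r * Real.log r ^ 2))) r := by
      have h1 := ((Real.hasDerivAt_log hr0.ne').const_mul 2).fun_inv (by positivity)
      have h2 := h1.const_add (-(n / 2 : ℝ))
      refine (h2.congr_deriv ?_).congr_of_eventuallyEq (.of_forall fun x => by simp [hb])
      field_simp
    -- Written without the truncated exponent `n - 1`, so that `n = 0`, that is `N = 2`, needs no
    -- separate treatment later.
    have d2 : HasDerivAt (fun r : ℝ => r ^ n) (n * r ^ n / r) r := by
      refine (hasDerivAt_pow n r).congr_deriv (Eq.symm ?_)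
      rcases Nat.eq_zero_or_pos n with h0 | h0
      · simp [h0]
      · rw [div_eq_iff hr0.ne', mul_assoc, ← pow_succ, Nat.sub_add_cancel h0]
    have d3 := ((hu.differentiable (by simp) r).hasDerivAt).pow 2
    have d4 := ((d1.mul d2).mul d3).deriv
    have e : deriv w r = _ := d4
    rw [e]
    have hH : hardyConst (n + 2) = (n / 2 : ℝ) ^ 2 := by
      simp [hardyConst]
    rw [hH]
    have hsq : 0 ≤ r ^ n * r * (deriv u r - b r / r * u r) ^ 2 := by positivity
    have expand : r ^ (n + 1) * deriv u r ^ 2 - (r ^ (n + 1) * ((n / 2 : ℝ) ^ 2 *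
        (1 / r ^ 2 * u r ^ 2) + 1 / 4 * (1 / (r ^ 2 * Real.log r ^ 2) * u r ^ 2)) +
        (((-(1 / (2 * r * Real.log r ^ 2))) * r ^ n + b r * (n * r ^ n / r)) * u r ^ 2 +
        b r * r ^ n * (2 * u r * deriv u r))) = r ^ n * r * (deriv u r - b r / r * u r) ^ 2 := by
      simp only [hb]
      field_simp
      ring
    have : ∀ a c d : ℝ, a - (c + d) = r ^ n * r * (deriv u r - b r / r * u r) ^ 2 → c + d ≤ a :=
      fun a c d h => by linarith
    refine this _ _ _ (Eq.trans ?_ expand)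
    simp
  rw [integral_add i1.integrableOn i3.integrableOn, hzero, add_zero] at key
  exact key

/-! ### Weights on the cone -/

open Classical in
/-- The direction `x / |x|` of a nonzero vector (and a fixed direction for `x = 0`). -/
noncomputable def sphereDir {N : ℕ} (s₀ : USphere N) (x : RN N) : USphere N :=
  if hx : x = 0 then s₀ else ⟨‖x‖⁻¹ • x, by simp [norm_smul, hx]⟩

lemma measurable_sphereDir {N : ℕ} (s₀ : USphere N) : Measurable (sphereDir s₀) := by
  classical
  refine Measurable.subtype_mk (f := fun x : RN N => ((sphereDir s₀ x : USphere N) : RN N)) ?_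
  have h : (fun x : RN N => ((sphereDir s₀ x : USphere N) : RN N)) =
      fun x => if x = 0 then (s₀ : RN N) else ‖x‖⁻¹ • x := by
    ext1 x
    by_cases hx : x = 0 <;> simp [sphereDir, hx]
  rw [h]
  exact Measurable.ite (measurableSet_singleton 0) measurable_const
    (measurable_norm.inv.smul measurable_id)

lemma sphereDir_smul {N : ℕ} (s₀ : USphere N) {r : ℝ} (hr : 0 < r) (s : USphere N) :
    sphereDir s₀ (r • (s : RN N)) = s := by
  rw [sphereDir, dif_neg (smul_sphere_ne_zero hr s)]
  ext1
  simp only [norm_smul_sphere hr.le, smul_smul, inv_mul_cancel₀ hr.ne', one_smul]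

lemma angular_eq_sphereDir {N : ℕ} (s₀ : USphere N) (f : USphere N → ℝ) {x : RN N} (hx : x ≠ 0) :
    angular f x = f (sphereDir s₀ x) := by
  rw [angular, dif_neg hx, sphereDir, dif_neg hx]

section Cone

variable {N : ℕ} {Ω : Set (USphere N)} {V : USphere N → ℝ} {ρ : ℝ}

/-- In polar coordinates the direction map is almost everywhere the first projection. Hence null
sets of `Ω` pull back to null sets of the cone, and properties of `V` that hold only almost
everywhere pass to `angular V`. -/
lemma quasiMeasurePreserving_sphereDir (hN : 1 ≤ N) (hΩ : IsOpen Ω) (hρ : 0 ≤ ρ)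
    (s₀ : USphere N) :
    Measure.QuasiMeasurePreserving (sphereDir s₀) (volume.restrict (coneDomain Ω ρ))
      ((surfaceMeasure N).restrict Ω) := by
  refine ⟨measurable_sphereDir s₀, ?_⟩
  rw [← (measurePreserving_polarMap hN hΩ hρ).map_eq,
    Measure.map_map (measurable_sphereDir s₀) continuous_polarMap.measurable]
  have h : sphereDir s₀ ∘ polarMap =ᵐ[polarMeasure Ω ρ] Prod.fst := by
    filter_upwards [ae_polarMeasure_snd Ω ρ] with p hp
    exact sphereDir_smul s₀ (hρ.trans_lt hp) p.1
  rw [Measure.map_congr h]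
  exact Measure.quasiMeasurePreserving_fst.absolutelyContinuous

lemma ae_mem_coneDomain (hΩ : IsOpen Ω) (hρ : 0 ≤ ρ) :
    ∀ᵐ x ∂(volume.restrict (coneDomain Ω ρ)), x ∈ coneDomain Ω ρ :=
  ae_restrict_mem (isOpen_coneDomain hΩ hρ).measurableSet

lemma exists_point_sphere (hN : 1 ≤ N) : Nonempty (USphere N) := by
  have : Nonempty (Fin N) := ⟨⟨0, hN⟩⟩
  have : Nontrivial (RN N) := inferInstance
  exact (NormedSpace.sphere_nonempty (E := RN N) (x := 0) (r := 1)).2 zero_le_one |>.to_subtype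

lemma memLp_angular (hN : 1 ≤ N) (hΩ : IsOpen Ω) (hρ : 0 ≤ ρ)
    (hV : MemLp V ⊤ ((surfaceMeasure N).restrict Ω)) :
    AEStronglyMeasurable (angular V) (volume.restrict (coneDomain Ω ρ)) ∧
    ∃ C, ∀ᵐ x ∂(volume.restrict (coneDomain Ω ρ)), |angular V x| ≤ C := by
  obtain ⟨s₀⟩ := exists_point_sphere hN
  have hq := quasiMeasurePreserving_sphereDir hN hΩ hρ s₀
  have hae : ∀ᵐ x ∂(volume.restrict (coneDomain Ω ρ)), V (sphereDir s₀ x) = angular V x := by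
    filter_upwards [ae_mem_coneDomain hΩ hρ] with x hx
    rw [angular_eq_sphereDir s₀ V]
    rw [← norm_pos_iff]
    exact hρ.trans_lt (lt_norm_of_mem_coneDomain hρ hx)
  refine ⟨(hV.1.comp_quasiMeasurePreserving hq).congr hae, ?_⟩
  obtain ⟨C, hC⟩ := eLpNormEssSup_lt_top_iff_isBoundedUnder.1 (by simpa using hV.2)
  refine ⟨C, ?_⟩
  filter_upwards [hae, hq.ae hC] with x hx1 hx2
  rw [← hx1]
  exact_mod_cast hx2

/-- The weights in the Hardy inequality are measurable, and bounded on compact subsets. -/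
lemma weights_bounded (hN : 1 ≤ N) (hΩ : IsOpen Ω) (hρ : 1 ≤ ρ)
    (hV : MemLp V ⊤ ((surfaceMeasure N).restrict Ω)) {K : Set (RN N)} (hK : IsCompact K)
    (hKG : K ⊆ coneDomain Ω ρ) {w : RN N → ℝ} (hw : w = (fun x => angular V x / ‖x‖ ^ 2) ∨
      w = (fun x => 1 / ‖x‖ ^ 2) ∨ w = (fun x => 1 / (‖x‖ ^ 2 * Real.log ‖x‖ ^ 2))) :
    AEStronglyMeasurable w (volume.restrict (coneDomain Ω ρ)) ∧
    ∃ C, ∀ᵐ x ∂(volume.restrict (coneDomain Ω ρ)), x ∈ K → |w x| ≤ C := by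
  have hρ0 : 0 ≤ ρ := by linarith
  have hnm : Measurable fun x : RN N => (‖x‖ ^ 2)⁻¹ := (measurable_norm.pow_const 2).inv
  rcases hw with rfl | rfl | rfl
  · obtain ⟨h1, C, hC⟩ := memLp_angular hN hΩ hρ0 hV
    refine ⟨?_, C, ?_⟩
    · simp only [div_eq_mul_inv]
      exact h1.mul hnm.aestronglyMeasurable
    · filter_upwards [hC, ae_mem_coneDomain hΩ hρ0] with x hx hxG _
      have h2 := hρ.trans_lt (lt_norm_of_mem_coneDomain hρ0 hxG)
      rw [abs_div, abs_of_nonneg (by positivity : (0 : ℝ) ≤ ‖x‖ ^ 2)]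
      exact (div_le_self (abs_nonneg _) (one_le_pow₀ h2.le)).trans hx
  · refine ⟨by simpa using hnm.aestronglyMeasurable, 1, ?_⟩
    filter_upwards [ae_mem_coneDomain hΩ hρ0] with x hxG _
    have h2 := hρ.trans_lt (lt_norm_of_mem_coneDomain hρ0 hxG)
    rw [abs_of_nonneg (by positivity)]
    exact div_le_self zero_le_one (one_le_pow₀ h2.le)
  · refine ⟨?_, ?_⟩
    · have : Measurable fun x : RN N => 1 / (‖x‖ ^ 2 * Real.log ‖x‖ ^ 2) := by fun_prop
      exact this.aestronglyMeasurable
    -- For `ρ = 1` this weight blows up at `|x| = 1`, so compactness of `K` inside the open cone is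
    -- essential here.
    · have hc : ContinuousOn (fun x : RN N => 1 / (‖x‖ ^ 2 * Real.log ‖x‖ ^ 2)) K := by
        have h2 : ∀ x ∈ K, 1 < ‖x‖ := fun x hx =>
          hρ.trans_lt (lt_norm_of_mem_coneDomain hρ0 (hKG hx))
        have h3 : ∀ x ∈ K, ‖x‖ ≠ 0 := fun x hx => by have := h2 x hx; positivity
        have h4 : ∀ x ∈ K, ‖x‖ ^ 2 * Real.log ‖x‖ ^ 2 ≠ 0 := fun x hx => by
          have := Real.log_pos (h2 x hx)
          have := h2 x hx
          positivity
        have h5 : ContinuousOn (fun x : RN N => Real.log ‖x‖) K :=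
          continuous_norm.continuousOn.log h3
        exact continuousOn_const.div ((continuous_norm.pow 2).continuousOn.mul (h5.pow 2)) h4
      obtain ⟨C, hC⟩ := hK.exists_bound_of_continuousOn hc
      exact ⟨C, .of_forall fun x hx => hC x hx⟩

lemma integrable_mul_of_bounded_on {α : Type*} [MeasurableSpace α] {μ : Measure α} {K : Set α}
    {w v : α → ℝ} {C : ℝ} (hw : AEStronglyMeasurable w μ) (hC : ∀ᵐ x ∂μ, x ∈ K → |w x| ≤ C)
    (hv : Integrable v μ) (hvK : ∀ᵐ x ∂μ, x ∉ K → v x = 0) :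
    Integrable (fun x => w x * v x) μ := by
  refine (hv.norm.const_mul C).mono' (hw.mul hv.1) ?_
  filter_upwards [hC, hvK] with x h1 h2
  by_cases hx : x ∈ K
  · rw [norm_mul]
    exact mul_le_mul_of_nonneg_right (h1 hx) (norm_nonneg _)
  · simp [h2 hx]

/-! ### Fubini on the cone -/

lemma integrable_polar (hN : 1 ≤ N) (hΩ : IsOpen Ω) (hρ : 0 ≤ ρ) {f : RN N → ℝ}
    (hf : IntegrableOn f (coneDomain Ω ρ)) :
    Integrable (fun p => f (polarMap p)) (polarMeasure Ω ρ) :=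
  (measurePreserving_polarMap hN hΩ hρ).integrable_comp_of_integrable hf

lemma integral_cone_mono_radial (hN : 1 ≤ N) (hΩ : IsOpen Ω) (hρ : 0 ≤ ρ) {f g : RN N → ℝ}
    (hf : IntegrableOn f (coneDomain Ω ρ)) (hg : IntegrableOn g (coneDomain Ω ρ))
    (h : ∀ s ∈ Ω, ∫ r, f (r • (s : RN N)) ∂(radialMeasure N ρ) ≤
      ∫ r, g (r • (s : RN N)) ∂(radialMeasure N ρ)) :
    ∫ x in coneDomain Ω ρ, f x ≤ ∫ x in coneDomain Ω ρ, g x := by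
  have hf' := integrable_polar hN hΩ hρ hf
  have hg' := integrable_polar hN hΩ hρ hg
  rw [integral_coneDomain hN hΩ hρ hf.1, integral_coneDomain hN hΩ hρ hg.1, polarMeasure,
    integral_prod _ hf', integral_prod _ hg']
  refine integral_mono_ae hf'.integral_prod_left hg'.integral_prod_left ?_
  filter_upwards [ae_restrict_mem hΩ.measurableSet] with s hs using h s hs

lemma integral_cone_mono_spherical (hN : 1 ≤ N) (hΩ : IsOpen Ω) (hρ : 0 ≤ ρ) {f g : RN N → ℝ}
    (hf : IntegrableOn f (coneDomain Ω ρ)) (hg : IntegrableOn g (coneDomain Ω ρ))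
    (h : ∀ r, ρ < r → ∫ s in Ω, f (r • (s : RN N)) ∂(surfaceMeasure N) ≤
      ∫ s in Ω, g (r • (s : RN N)) ∂(surfaceMeasure N)) :
    ∫ x in coneDomain Ω ρ, f x ≤ ∫ x in coneDomain Ω ρ, g x := by
  have hf' := integrable_polar hN hΩ hρ hf
  have hg' := integrable_polar hN hΩ hρ hg
  rw [integral_coneDomain hN hΩ hρ hf.1, integral_coneDomain hN hΩ hρ hg.1, polarMeasure,
    integral_prod_symm _ hf', integral_prod_symm _ hg']
  refine integral_mono_ae hf'.integral_prod_right hg'.integral_prod_right ?_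
  filter_upwards [ae_radialMeasure_mem N ρ] with r hr using h r hr

/-! ### Integrating both halves of the gradient: the inequality for smooth functions -/

/-- The part of `|∇v|²` that comes from the radial derivative. -/
noncomputable def radialPart {N : ℕ} (v : RN N → ℝ) (x : RN N) : ℝ :=
  (⟪gradient v x, x⟫ / ‖x‖) ^ 2

lemma continuous_gradient {v : RN N → ℝ} (hv : ContDiff ℝ 1 v) : Continuous (gradient v) :=
  (InnerProductSpace.toDual ℝ (RN N)).symm.continuous.comp (hv.continuous_fderiv (by simp))

lemma hasCompactSupport_gradient {v : RN N → ℝ} (hc : HasCompactSupport v) :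
    HasCompactSupport (gradient v) :=
  (hc.fderiv (𝕜 := ℝ)).comp_left (g := (InnerProductSpace.toDual ℝ (RN N)).symm) (map_zero _)

lemma integrable_gradient_sq {v : RN N → ℝ} (hv : ContDiff ℝ 1 v) (hc : HasCompactSupport v) :
    Integrable (fun x => ‖gradient v x‖ ^ 2) := by
  have h := (continuous_gradient hv).norm
  refine (h.pow 2).integrable_of_hasCompactSupport ?_
  exact (hasCompactSupport_gradient hc).mono fun x hx h0 => hx (by simp [h0])

lemma integrable_radialPart {v : RN N → ℝ} (hv : ContDiff ℝ 1 v) (hc : HasCompactSupport v) :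
    Integrable (radialPart v) := by
  have h := continuous_gradient hv
  refine (integrable_gradient_sq hv hc).mono' ?_ (.of_forall fun x => ?_)
  · have h1 : Measurable fun x : RN N => ⟪gradient v x, x⟫ := (h.inner continuous_id).measurable
    exact ((h1.div measurable_norm).pow_const 2).aestronglyMeasurable
  · rw [radialPart, Real.norm_of_nonneg (sq_nonneg _), ← sq_abs, abs_div, abs_norm]
    refine pow_le_pow_left₀ (by positivity) ?_ 2
    exact div_le_of_le_mul₀ (norm_nonneg _) (norm_nonneg _) (abs_real_inner_le_norm _ _)

lemma radialPart_smul {v : RN N → ℝ} {r : ℝ} (hr : 0 < r) {s : USphere N}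
    (hv : DifferentiableAt ℝ v (r • (s : RN N))) :
    radialPart v (r • (s : RN N)) = deriv (fun r : ℝ => v (r • (s : RN N))) r ^ 2 := by
  rw [radialPart, (hasDerivAt_ray hv).deriv, real_inner_smul_right, norm_smul_sphere hr.le,
    mul_div_cancel_left₀ _ hr.ne']

lemma gradient_sub_radialPart_smul {v : RN N → ℝ} {r : ℝ} (hr : 0 < r) {s : USphere N}
    (hv : DifferentiableAt ℝ v (r • (s : RN N))) :
    ‖gradient v (r • (s : RN N))‖ ^ 2 - radialPart v (r • (s : RN N)) =
      ‖sphereGrad (fun s : USphere N => v (r • (s : RN N))) s‖ ^ 2 / r ^ 2 := by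
  rw [norm_gradient_sq_polar hr hv, radialPart_smul hr hv, (hasDerivAt_ray hv).deriv]
  ring

lemma radial_hardy_ray (hN : 2 ≤ N) (hρ : 1 ≤ ρ) {v : RN N → ℝ} (hv : ContDiff ℝ 1 v)
    (hc : HasCompactSupport v) (hs : tsupport v ⊆ coneDomain Ω ρ) (s : USphere N) :
    ∫ r, (hardyConst N * (1 / r ^ 2 * v (r • (s : RN N)) ^ 2) +
      1 / 4 * (1 / (r ^ 2 * Real.log r ^ 2) * v (r • (s : RN N)) ^ 2)) ∂(radialMeasure N ρ) ≤
    ∫ r, deriv (fun r : ℝ => v (r • (s : RN N))) r ^ 2 ∂(radialMeasure N ρ) := by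
  have hρ0 : 0 ≤ ρ := by linarith
  -- For `r < 0` the line through `s` meets the opposite ray, where `v` may be nonzero if `-s ∈ Ω`.
  -- Cutting it off keeps `u` smooth, because the remaining support stays beyond `ρ`.
  set u : ℝ → ℝ := fun r => if 0 < r then v (r • (s : RN N)) else 0 with hu
  have hev : ∀ r, 0 < r → u =ᶠ[𝓝 r] fun r => v (r • (s : RN N)) := fun r hr => by
    filter_upwards [Ioi_mem_nhds hr] with r' hr'
    simp [hu, mem_Ioi.1 hr']
  set T : Set ℝ := Ici 0 ∩ (fun r : ℝ => r • (s : RN N)) ⁻¹' tsupport v with hT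
  have hTc : IsCompact T :=
    ((isClosedEmbedding_smul_left (sphere_ne_zero s)).isCompact_preimage hc).inter_left
      isClosed_Ici
  have huT : tsupport u ⊆ T := by
    refine closure_minimal (fun r hr => ?_) hTc.isClosed
    by_cases h0 : 0 < r
    · exact ⟨h0.le, subset_tsupport v fun h => hr (by simp [hu, h])⟩
    · exact absurd (by simp [hu, h0]) hr
  have hTρ : T ⊆ Ioi ρ := by
    rintro r ⟨h0, hr⟩
    have := lt_norm_of_mem_coneDomain hρ0 (hs hr)
    rwa [norm_smul_sphere h0] at this
  have huc : ContDiff ℝ 1 u := by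
    refine contDiff_of_forall_mem_tsupport fun r hr => ?_
    refine ContDiffAt.congr_of_eventuallyEq ?_ (hev r (hρ0.trans_lt (hTρ (huT hr))))
    have h1 : ContDiff ℝ 1 fun r : ℝ => v (r • (s : RN N)) :=
      hv.comp (contDiff_id.smul contDiff_const)
    exact h1.contDiffAt
  have key := radial_hardy hN hρ huc (hTc.of_isClosed_subset (isClosed_tsupport _) huT)
    (huT.trans hTρ)
  convert key using 1
  · refine integral_congr_ae ?_
    filter_upwards [ae_radialMeasure_mem N ρ] with r hr
    rw [(hev r (hρ0.trans_lt hr)).eq_of_nhds]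
  · refine integral_congr_ae ?_
    filter_upwards [ae_radialMeasure_mem N ρ] with r hr
    rw [(hev r (hρ0.trans_lt hr)).deriv_eq]

/-- The improved Hardy inequality for smooth functions with compact support. -/
lemma improvedHardy_of_smooth (hN : 2 ≤ N) (hΩ : IsOpen Ω) (hρ : 1 ≤ ρ)
    (hV : MemLp V ⊤ ((surfaceMeasure N).restrict Ω)) {lam : ℝ}
    (hlam : IsPrincipalEigenvalue Ω V lam) {v : RN N → ℝ} (hv : ContDiff ℝ ∞ v)
    (hc : HasCompactSupport v) (hs : tsupport v ⊆ coneDomain Ω ρ) :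
    (hardyConst N + lam) * (∫ x in coneDomain Ω ρ, 1 / ‖x‖ ^ 2 * v x ^ 2) +
      1 / 4 * (∫ x in coneDomain Ω ρ, 1 / (‖x‖ ^ 2 * Real.log ‖x‖ ^ 2) * v x ^ 2) +
      ∫ x in coneDomain Ω ρ, angular V x / ‖x‖ ^ 2 * v x ^ 2 ≤
    ∫ x in coneDomain Ω ρ, ‖gradient v x‖ ^ 2 := by
  have hN1 : 1 ≤ N := by omega
  have hρ0 : 0 ≤ ρ := by linarith
  have hd : Differentiable ℝ v := hv.differentiable (by simp)
  have hv1 : ContDiff ℝ 1 v := hv.of_le (by simp)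
  have hv2 : IntegrableOn (fun x => v x ^ 2) (coneDomain Ω ρ) :=
    ((hv.continuous.pow 2).integrable_of_hasCompactSupport
      (hc.mono fun x hx h0 => hx (by simp [h0]))).integrableOn
  have hv0 : ∀ᵐ x ∂(volume.restrict (coneDomain Ω ρ)), x ∉ tsupport v → v x ^ 2 = 0 :=
    .of_forall fun x hx => by simp [image_eq_zero_of_notMem_tsupport hx]
  have hw : ∀ w : RN N → ℝ, (w = (fun x => angular V x / ‖x‖ ^ 2) ∨
      w = (fun x => 1 / ‖x‖ ^ 2) ∨ w = (fun x => 1 / (‖x‖ ^ 2 * Real.log ‖x‖ ^ 2))) →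
      IntegrableOn (fun x => w x * v x ^ 2) (coneDomain Ω ρ) := by
    intro w hw
    obtain ⟨h1, C, hC⟩ := weights_bounded hN1 hΩ hρ hV hc hs hw
    exact integrable_mul_of_bounded_on h1 hC hv2 hv0
  have iV := hw _ (Or.inl rfl)
  have iD := hw _ (Or.inr (Or.inl rfl))
  have iL := hw _ (Or.inr (Or.inr rfl))
  have iG : IntegrableOn (fun x => ‖gradient v x‖ ^ 2) (coneDomain Ω ρ) :=
    (integrable_gradient_sq hv1 hc).integrableOn
  have iR : IntegrableOn (radialPart v) (coneDomain Ω ρ) :=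
    (integrable_radialPart hv1 hc).integrableOn
  have radial : ∫ x in coneDomain Ω ρ, (hardyConst N * (1 / ‖x‖ ^ 2 * v x ^ 2) +
      1 / 4 * (1 / (‖x‖ ^ 2 * Real.log ‖x‖ ^ 2) * v x ^ 2)) ≤
      ∫ x in coneDomain Ω ρ, radialPart v x := by
    refine integral_cone_mono_radial hN1 hΩ hρ0 ((iD.const_mul _).add (iL.const_mul _)) iR ?_
    intro s hsΩ
    have e1 : ∫ r, (hardyConst N * (1 / ‖r • (s : RN N)‖ ^ 2 * v (r • (s : RN N)) ^ 2) +
        1 / 4 * (1 / (‖r • (s : RN N)‖ ^ 2 * Real.log ‖r • (s : RN N)‖ ^ 2) *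
          v (r • (s : RN N)) ^ 2)) ∂(radialMeasure N ρ) =
        ∫ r, (hardyConst N * (1 / r ^ 2 * v (r • (s : RN N)) ^ 2) +
        1 / 4 * (1 / (r ^ 2 * Real.log r ^ 2) * v (r • (s : RN N)) ^ 2))
          ∂(radialMeasure N ρ) := by
      refine integral_congr_ae ?_
      filter_upwards [ae_radialMeasure_mem N ρ] with r hr
      rw [norm_smul_sphere (hρ0.trans hr.le)]
    have e2 : ∫ r, radialPart v (r • (s : RN N)) ∂(radialMeasure N ρ) =
        ∫ r, deriv (fun r : ℝ => v (r • (s : RN N))) r ^ 2 ∂(radialMeasure N ρ) := by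
      refine integral_congr_ae ?_
      filter_upwards [ae_radialMeasure_mem N ρ] with r hr
      exact radialPart_smul (hρ0.trans_lt hr) (hd _)
    rw [e1, e2]
    exact radial_hardy_ray hN hρ (hv.of_le (by simp)) hc hs s
  -- On the sphere of radius `r`, this is the variational inequality for the slice of `v`,
  -- multiplied by `1 / r²`.
  have spherical : ∫ x in coneDomain Ω ρ, lam * (1 / ‖x‖ ^ 2 * v x ^ 2) ≤
      ∫ x in coneDomain Ω ρ, (‖gradient v x‖ ^ 2 - radialPart v x -
        angular V x / ‖x‖ ^ 2 * v x ^ 2) := by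
    refine integral_cone_mono_spherical hN1 hΩ hρ0 (iD.const_mul _) ((iG.sub iR).sub iV) ?_
    intro r hr
    have hr0 : 0 < r := hρ0.trans_lt hr
    have ht := isSphereTest_slice hρ0 hr0 hv hs
    have key := hlam.mul_integral_sq_le hV ht
    rw [sphereForm] at key
    have e1 : ∫ s in Ω, lam * (1 / ‖r • (s : RN N)‖ ^ 2 * v (r • (s : RN N)) ^ 2)
        ∂(surfaceMeasure N) = (1 / r ^ 2) *
          (lam * ∫ s in Ω, v (r • (s : RN N)) ^ 2 ∂(surfaceMeasure N)) := by
      rw [← integral_const_mul, ← integral_const_mul]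
      congr 1
      ext s
      rw [norm_smul_sphere hr0.le]
      ring
    have e2 : ∫ s in Ω, (‖gradient v (r • (s : RN N))‖ ^ 2 - radialPart v (r • (s : RN N)) -
        angular V (r • (s : RN N)) / ‖r • (s : RN N)‖ ^ 2 * v (r • (s : RN N)) ^ 2)
        ∂(surfaceMeasure N) = (1 / r ^ 2) * ∫ s in Ω,
          (‖sphereGrad (fun s : USphere N => v (r • (s : RN N))) s‖ ^ 2 -
            V s * v (r • (s : RN N)) ^ 2) ∂(surfaceMeasure N) := by
      rw [← integral_const_mul]
      congr 1
      ext s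
      rw [gradient_sub_radialPart_smul hr0 (hd _), norm_smul_sphere hr0.le, angular_smul V hr0]
      ring
    rw [e1, e2]
    exact mul_le_mul_of_nonneg_left key (by positivity)
  rw [integral_add (iD.const_mul _) (iL.const_mul _), integral_const_mul, integral_const_mul]
    at radial
  have iGR : IntegrableOn (fun x => ‖gradient v x‖ ^ 2 - radialPart v x) (coneDomain Ω ρ) :=
    iG.sub iR
  rw [integral_sub iGR iV, integral_sub iG iR, integral_const_mul] at spherical
  linarith

end Cone

/-! ### Mollification -/

section Mollify

open scoped Convolution
open ContinuousLinearMap (lsmul)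

variable {N : ℕ} {G K : Set (RN N)} {v : RN N → ℝ} {g : RN N → RN N} {k : RN N → ℝ} {δ : ℝ}

lemma tsupport_convolution_subset (hK : IsCompact K) (hkδ : tsupport k ⊆ Metric.closedBall 0 δ)
    (hδ : 0 ≤ δ) (hvK : Function.support v ⊆ K) :
    tsupport (k ⋆[lsmul ℝ ℝ] v) ⊆ Metric.cthickening δ K := by
  refine closure_minimal ?_ Metric.isClosed_cthickening
  refine (support_convolution_subset (L := lsmul ℝ ℝ)).trans ?_
  rintro _ ⟨a, ha, b, hb, rfl⟩
  rw [hK.cthickening_eq_biUnion_closedBall hδ, mem_iUnion₂]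
  refine ⟨b, hvK hb, ?_⟩
  have := hkδ (subset_tsupport k ha)
  simpa [dist_eq_norm] using this

/-- The gradient of a mollified function is the mollified weak gradient, tested against a vector. -/
lemma inner_gradient_convolution (hG : IsOpen G) (hk : ContDiff ℝ ∞ k) (hkc : HasCompactSupport k)
    (hkδ : tsupport k ⊆ Metric.closedBall 0 δ) (hv : Integrable v)
    (hvG : Function.support v ⊆ G) (hg : LocallyIntegrable (G.indicator g))
    (hweak : ∀ φ : RN N → ℝ, ContDiff ℝ ∞ φ → HasCompactSupport φ → tsupport φ ⊆ G →
      ∫ x in G, v x • gradient φ x = - ∫ x in G, φ x • g x)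
    {x : RN N} (hx : Metric.closedBall x δ ⊆ G) (y : RN N) :
    ⟪gradient (k ⋆[lsmul ℝ ℝ] v) x, y⟫ = ∫ t, k (x - t) * ⟪G.indicator g t, y⟫ := by
  have hk1 : ContDiff ℝ 1 k := hk.of_le (by simp)
  have hkd : Differentiable ℝ k := hk.differentiable (by simp)
  have hswap : (k ⋆[lsmul ℝ ℝ] v) = (v ⋆[lsmul ℝ ℝ] k) := by
    ext z
    rw [convolution_lsmul_swap, convolution_lsmul]
    simp only [smul_eq_mul, mul_comm]
  have h1 := hkc.hasFDerivAt_convolution_right (lsmul ℝ ℝ) hv.locallyIntegrable hk1 x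
  rw [inner_gradient_left, hswap, h1.fderiv,
    convolution_precompR_apply _ hv.locallyIntegrable (hkc.fderiv ℝ) (hk1.continuous_fderiv (by simp)),
    convolution_lsmul]
  -- The translated reflected kernel is admissible in the weak identity because its support lies in
  -- the `δ`-ball about `x`. The sign from differentiating in `t` cancels the one from integration
  -- by parts.
  set φ : RN N → ℝ := fun t => k (x - t) with hφ
  have hφc : ContDiff ℝ ∞ φ := hk.comp (contDiff_const.sub contDiff_id)
  have hφs : HasCompactSupport φ := hkc.comp_homeomorph (Homeomorph.subLeft x)
  have hφt : tsupport φ ⊆ Metric.closedBall x δ := by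
    refine closure_minimal (fun t ht => ?_) Metric.isClosed_closedBall
    have := hkδ (subset_tsupport k ht)
    rw [mem_closedBall_zero_iff] at this
    rwa [Metric.mem_closedBall, dist_comm, dist_eq_norm]
  have hgrad : ∀ t, gradient φ t = -gradient k (x - t) := by
    intro t
    refine HasGradientAt.gradient ?_
    rw [hasGradientAt_iff_hasFDerivAt]
    have h2 := (hkd (x - t)).hasFDerivAt.comp t ((hasFDerivAt_id t).const_sub x)
    refine h2.congr_fderiv ?_
    ext z
    rw [map_neg, neg_apply, InnerProductSpace.toDual_apply_apply,
      inner_gradient_left]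
    simp
  have hw := hweak φ hφc hφs (hφt.trans hx)
  have hi1 : IntegrableOn (fun t => v t • gradient φ t) G := by
    have hcont : Continuous (gradient φ) := continuous_gradient (hφc.of_le (by simp))
    obtain ⟨C, hC⟩ := hcont.bounded_above_of_compact_support (hasCompactSupport_gradient hφs)
    exact (hv.integrableOn.smul_bdd C hcont.aestronglyMeasurable (.of_forall hC))
  have hi2 : Integrable (fun t => φ t • G.indicator g t) :=
    hg.integrable_smul_left_of_hasCompactSupport hφc.continuous hφs
  have hi2' : IntegrableOn (fun t => φ t • g t) G := by
    rw [← integrable_indicator_iff hG.measurableSet]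
    refine hi2.congr (.of_forall fun t => ?_)
    by_cases ht : t ∈ G <;> simp [ht]
  have hw' := congrArg (fun z => ⟪y, z⟫) hw
  simp only [inner_neg_right] at hw'
  rw [← integral_inner hi1, ← integral_inner hi2'] at hw'
  have e1 : ∫ t in G, ⟪y, v t • gradient φ t⟫ = -∫ t, v t • (fderiv ℝ k (x - t)) y := by
    rw [setIntegral_eq_integral_of_forall_compl_eq_zero, ← integral_neg]
    · congr 1
      ext t
      rw [hgrad, real_inner_smul_right, inner_neg_right, real_inner_comm, inner_gradient_left]
      simp
    · intro t ht
      have : v t = 0 := by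
        by_contra h
        exact ht (hvG h)
      simp [this]
  have e2 : ∫ t in G, ⟪y, φ t • g t⟫ = ∫ t, k (x - t) * ⟪G.indicator g t, y⟫ := by
    rw [← integral_indicator hG.measurableSet]
    congr 1
    ext t
    by_cases ht : t ∈ G
    · simp [ht, real_inner_smul_right, real_inner_comm, hφ]
    · simp [ht]
  rw [e1, e2, neg_inj] at hw'
  exact hw'

/-- Jensen's inequality for averaging by `k`. With `a = ∇(k ⋆ v)(x)`, one has `|a|² = ∫ k(x - t) ⟪g,
a⟫ ≤ ½ ∫ k(x - t) |g|² + ½ |a|²`. The margin `δ + δ` keeps the `δ`-ball about any point of the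
`δ`-neighbourhood of `K` inside `G`; outside that neighbourhood the gradient vanishes. -/
lemma norm_gradient_convolution_sq_le (hG : IsOpen G) (hK : IsCompact K) (hδ : 0 ≤ δ)
    (hKG : Metric.cthickening (δ + δ) K ⊆ G) (hk : ContDiff ℝ ∞ k)
    (hkc : HasCompactSupport k) (hkδ : tsupport k ⊆ Metric.closedBall 0 δ) (hk0 : ∀ x, 0 ≤ k x)
    (hk1 : ∫ x, k x = 1) (hv : Integrable v)
    (hvK : Function.support v ⊆ K) (hg : MemLp (G.indicator g) 2)
    (hweak : ∀ φ : RN N → ℝ, ContDiff ℝ ∞ φ → HasCompactSupport φ → tsupport φ ⊆ G →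
      ∫ x in G, v x • gradient φ x = - ∫ x in G, φ x • g x) (x : RN N) :
    ‖gradient (k ⋆[lsmul ℝ ℝ] v) x‖ ^ 2 ≤
      (k ⋆[lsmul ℝ ℝ] fun t => ‖G.indicator g t‖ ^ 2) x := by
  rw [convolution_lsmul_swap]
  by_cases hx : x ∈ Metric.cthickening δ K
  · have hball : Metric.closedBall x δ ⊆ G := by
      refine Subset.trans ?_ hKG
      refine (Metric.closedBall_subset_cthickening hx δ).trans ?_
      exact Metric.cthickening_cthickening_subset hδ hδ K
    have hvG : Function.support v ⊆ G :=
      hvK.trans ((Metric.self_subset_cthickening K).trans hKG)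
    have hgl : LocallyIntegrable (G.indicator g) := hg.locallyIntegrable (by norm_num)
    set a := gradient (k ⋆[lsmul ℝ ℝ] v) x with ha
    have h1 := inner_gradient_convolution hG hk hkc hkδ hv hvG hgl hweak hball a
    rw [← ha, real_inner_self_eq_norm_sq] at h1
    have hkx : Continuous fun t => k (x - t) := hk.continuous.comp (continuous_const.sub continuous_id)
    have hkxs : HasCompactSupport fun t => k (x - t) := hkc.comp_homeomorph (Homeomorph.subLeft x)
    have hgsq : Integrable fun t => ‖G.indicator g t‖ ^ 2 := hg.integrable_norm_pow (by simp)
    have i1 : Integrable fun t => k (x - t) * ‖G.indicator g t‖ ^ 2 :=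
      hgsq.locallyIntegrable.integrable_smul_left_of_hasCompactSupport hkx hkxs
    have i2 : Integrable fun t => k (x - t) * ‖a‖ ^ 2 :=
      (hkx.integrable_of_hasCompactSupport hkxs).mul_const _
    have i3 : Integrable fun t => k (x - t) * ⟪G.indicator g t, a⟫ := by
      have := (hgl.integrable_smul_left_of_hasCompactSupport hkx hkxs).inner_const (𝕜 := ℝ) a
      simpa [real_inner_smul_left] using this
    have h2 : ∫ t, k (x - t) * ⟪G.indicator g t, a⟫ ≤
        ∫ t, (1 / 2 * (k (x - t) * ‖G.indicator g t‖ ^ 2) + 1 / 2 * (k (x - t) * ‖a‖ ^ 2)) := by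
      refine integral_mono i3 ((i1.const_mul _).add (i2.const_mul _)) fun t => ?_
      have h3 := norm_sub_sq_real (G.indicator g t) a
      have h4 := hk0 (x - t)
      have h5 : 0 ≤ k (x - t) * ‖G.indicator g t - a‖ ^ 2 := by positivity
      rw [h3] at h5
      simp only
      linarith
    have h6 : ∫ t, k (x - t) * ‖a‖ ^ 2 = ‖a‖ ^ 2 := by
      rw [integral_mul_const, integral_sub_left_eq_self k volume x, hk1, one_mul]
    rw [integral_add (i1.const_mul _) (i2.const_mul _), integral_const_mul, integral_const_mul,
      h6, ← h1] at h2
    simp only [smul_eq_mul]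
    linarith
  · have h0 : gradient (k ⋆[lsmul ℝ ℝ] v) x = 0 := by
      have h1 : x ∉ tsupport (k ⋆[lsmul ℝ ℝ] v) := fun h =>
        hx (tsupport_convolution_subset hK hkδ hδ hvK h)
      rw [(notMem_tsupport_iff_eventuallyEq.1 h1).gradient_eq]
      exact gradient_fun_const x (0 : ℝ)
    rw [h0]
    simp only [norm_zero, smul_eq_mul]
    rw [zero_pow two_ne_zero]
    exact integral_nonneg fun t => mul_nonneg (hk0 _) (by positivity)

/-- Approximation of bounded `H¹` functions with compact support by smooth ones. -/
lemma IsH1cLinfty.exists_smooth_approx (hG : IsOpen G) (h : IsH1cLinfty G v g) :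
    ∃ (K : Set (RN N)) (M : ℝ) (u : ℕ → RN N → ℝ), IsCompact K ∧ K ⊆ G ∧
      (∀ᵐ x ∂(volume.restrict G), x ∉ K → v x = 0) ∧
      (∀ n, ContDiff ℝ ∞ (u n)) ∧ (∀ n, tsupport (u n) ⊆ K) ∧ (∀ n x, |u n x| ≤ M) ∧
      (∀ᵐ x ∂(volume.restrict G), Tendsto (fun n => u n x) atTop (𝓝 (v x))) ∧
      ∀ n, ∫ x in G, ‖gradient (u n) x‖ ^ 2 ≤ ∫ x in G, ‖g x‖ ^ 2 := by
  obtain ⟨hv2, hg2, hweak, hvtop, K, hK, hKG, hvK⟩ := h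
  obtain ⟨d, hd, hdG⟩ := hK.exists_cthickening_subset_open hG hKG
  -- The values of `v` outside `G` are arbitrary, so `v` is replaced by a function on the whole
  -- space that vanishes off `K`.
  set v₀ : RN N → ℝ := K.indicator v with hv₀
  have hvae : v =ᵐ[volume.restrict G] v₀ := by
    have h1 : ∀ᵐ x ∂(volume.restrict G), x ∉ K → v x = 0 := by
      rw [ae_restrict_iff' (hG.measurableSet.diff hK.measurableSet)] at hvK
      rw [ae_restrict_iff' hG.measurableSet]
      filter_upwards [hvK] with x hx hxG hxK using hx ⟨hxG, hxK⟩
    filter_upwards [h1] with x hx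
    by_cases hxK : x ∈ K
    · simp [hv₀, hxK]
    · simp [hv₀, hxK, hx hxK]
  have hv₀K : Function.support v₀ ⊆ K := support_indicator_subset
  obtain ⟨M, hM0, hM⟩ : ∃ M, 0 ≤ M ∧ ∀ᵐ x, |v₀ x| ≤ M := by
    obtain ⟨C, hC⟩ := eLpNormEssSup_lt_top_iff_isBoundedUnder.1 (by simpa using hvtop.2)
    refine ⟨C, C.2, ?_⟩
    have hC' := (ae_restrict_iff' hG.measurableSet).1 hC
    filter_upwards [hC'] with x hx
    by_cases hxK : x ∈ K
    · simpa [hv₀, hxK] using (by exact_mod_cast hx (hKG hxK) : ‖v x‖ ≤ C)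
    · simp [hv₀, hxK]
  have hv₀i : Integrable v₀ := by
    rw [hv₀, integrable_indicator_iff hK.measurableSet]
    have : MemLp v 2 (volume.restrict K) := hv2.mono_measure (Measure.restrict_mono hKG le_rfl)
    have hfin : IsFiniteMeasure (volume.restrict K : Measure (RN N)) :=
      ⟨by rw [Measure.restrict_apply_univ]; exact hK.measure_lt_top⟩
    exact this.integrable (by norm_num)
  have hgi : MemLp (G.indicator g) 2 := (memLp_indicator_iff_restrict hG.measurableSet).2 hg2
  have hgsq : Integrable fun t => ‖G.indicator g t‖ ^ 2 := hgi.integrable_norm_pow (by simp)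
  have hweak₀ : ∀ φ : RN N → ℝ, ContDiff ℝ ∞ φ → HasCompactSupport φ → tsupport φ ⊆ G →
      ∫ x in G, v₀ x • gradient φ x = - ∫ x in G, φ x • g x := by
    intro φ h1 h2 h3
    rw [← hweak φ h1 h2 h3]
    refine integral_congr_ae ?_
    filter_upwards [hvae] with x hx
    rw [hx]
  have hR : ∀ n : ℕ, 0 < d / 2 / ((n : ℝ) + 1) := fun n => by positivity
  -- Outer radii at most `d / 2` fit the margin `d / 2 + d / 2 = d` of the gradient estimate. The
  -- fixed ratio `2` of outer to inner radius is what almost everywhere convergence of the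
  -- mollifications requires.
  let B : ℕ → ContDiffBump (0 : RN N) := fun n =>
    ⟨d / 2 / ((n : ℝ) + 1) / 2, d / 2 / ((n : ℝ) + 1), half_pos (hR n), half_lt_self (hR n)⟩
  have hBle : ∀ n, (B n).rOut ≤ d / 2 := fun n =>
    div_le_self (by positivity) (by simp)
  have hBlim : Tendsto (fun n => (B n).rOut) atTop (𝓝 0) := by
    have := tendsto_one_div_add_atTop_nhds_zero_nat (𝕜 := ℝ)
    have h2 := this.const_mul (d / 2)
    simpa [B, div_eq_mul_inv] using h2
  set k : ℕ → RN N → ℝ := fun n => (B n).normed volume with hk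
  have hkδ : ∀ n, tsupport (k n) ⊆ Metric.closedBall 0 (d / 2) := fun n => by
    rw [hk, (B n).tsupport_normed_eq]
    exact Metric.closedBall_subset_closedBall (hBle n)
  have hkc : ∀ n, HasCompactSupport (k n) := fun n => (B n).hasCompactSupport_normed
  have hks : ∀ n, ContDiff ℝ ∞ (k n) := fun n => (B n).contDiff_normed
  have hk0 : ∀ n x, 0 ≤ k n x := fun n => (B n).nonneg_normed
  have hk1 : ∀ n, ∫ x, k n x = 1 := fun n => (B n).integral_normed
  have hKle : Metric.cthickening (d / 2) K ⊆ Metric.cthickening d K :=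
    Metric.cthickening_mono (by linarith) K
  refine ⟨Metric.cthickening (d / 2) K, M, fun n => k n ⋆[lsmul ℝ ℝ] v₀, hK.cthickening,
    hKle.trans hdG, ?_, fun n => ?_, fun n => ?_, fun n x => ?_, ?_, fun n => ?_⟩
  · filter_upwards [hvae] with x hx hxK
    rw [hx, hv₀, indicator_of_notMem fun h => hxK (Metric.self_subset_cthickening K h)]
  · exact (hkc n).contDiff_convolution_left _ (hks n) hv₀i.locallyIntegrable
  · exact tsupport_convolution_subset hK (hkδ n) (by positivity) hv₀K
  · simp only [convolution_lsmul_swap]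
    have hkx : Continuous fun t => k n (x - t) :=
      (hks n).continuous.comp (continuous_const.sub continuous_id)
    have hkxs : HasCompactSupport fun t => k n (x - t) :=
      (hkc n).comp_homeomorph (Homeomorph.subLeft x)
    have h1 : ‖∫ t, k n (x - t) • v₀ t‖ ≤ ∫ t, k n (x - t) * M := by
      refine norm_integral_le_of_norm_le
        ((hkx.integrable_of_hasCompactSupport hkxs).mul_const M) ?_
      filter_upwards [hM] with t ht
      rw [norm_smul, Real.norm_of_nonneg (hk0 n _)]
      exact mul_le_mul_of_nonneg_left ht (hk0 n _)
    rwa [integral_mul_const, integral_sub_left_eq_self (k n) volume x, hk1, one_mul] at h1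
  · have h1 := ContDiffBump.ae_convolution_tendsto_right_of_locallyIntegrable (K := 2)
      (φ := B) (μ := volume) hBlim (.of_forall fun n => by simp [B]; linarith)
      hv₀i.locallyIntegrable
    filter_upwards [ae_restrict_of_ae h1, hvae] with x hx1 hx2
    rw [hx2]
    exact hx1
  · have hle := fun x => norm_gradient_convolution_sq_le hG hK (by positivity)
      (by simpa using hdG) (hks n) (hkc n) (hkδ n) (hk0 n) (hk1 n) hv₀i hv₀K hgi hweak₀ x
    have hki : Integrable (k n) := (hks n).continuous.integrable_of_hasCompactSupport (hkc n)
    have hci := hki.integrable_convolution (lsmul ℝ ℝ) hgsq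
    have hu1 : ContDiff ℝ 1 (k n ⋆[lsmul ℝ ℝ] v₀) :=
      ((hkc n).contDiff_convolution_left (n := 1) _ ((hks n).of_le (by simp))
        hv₀i.locallyIntegrable)
    have hus : HasCompactSupport (k n ⋆[lsmul ℝ ℝ] v₀) :=
      hK.cthickening.of_isClosed_subset (isClosed_tsupport _)
        (tsupport_convolution_subset hK (hkδ n) (by positivity) hv₀K)
    have hgu := integrable_gradient_sq hu1 hus
    calc ∫ x in G, ‖gradient (k n ⋆[lsmul ℝ ℝ] v₀) x‖ ^ 2
        ≤ ∫ x, ‖gradient (k n ⋆[lsmul ℝ ℝ] v₀) x‖ ^ 2 :=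
          setIntegral_le_integral hgu (.of_forall fun x => by positivity)
      _ ≤ ∫ x, (k n ⋆[lsmul ℝ ℝ] fun t => ‖G.indicator g t‖ ^ 2) x :=
          integral_mono hgu hci hle
      _ = ∫ x, ‖G.indicator g x‖ ^ 2 := by
          rw [integral_convolution _ hki hgsq, hk1]
          simp
      _ = ∫ x in G, ‖g x‖ ^ 2 := by
          rw [← integral_indicator hG.measurableSet]
          congr 1
          ext x
          by_cases hx : x ∈ G <;> simp [hx]

end Mollify

/-! ### The inequality for general admissible functions -/

section General

variable {N : ℕ} {Ω : Set (USphere N)} {V : USphere N → ℝ} {ρ lam : ℝ}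

lemma tendsto_integral_weight {G K : Set (RN N)} (hK : IsCompact K) {w v : RN N → ℝ}
    {u : ℕ → RN N → ℝ} {C M : ℝ} (hw : AEStronglyMeasurable w (volume.restrict G))
    (hC : ∀ᵐ x ∂(volume.restrict G), x ∈ K → |w x| ≤ C) (hu : ∀ n, Continuous (u n))
    (huK : ∀ n, tsupport (u n) ⊆ K) (huM : ∀ n x, |u n x| ≤ M)
    (hlim : ∀ᵐ x ∂(volume.restrict G), Tendsto (fun n => u n x) atTop (𝓝 (v x))) :
    Tendsto (fun n => ∫ x in G, w x * u n x ^ 2) atTop (𝓝 (∫ x in G, w x * v x ^ 2)) := by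
  refine tendsto_integral_of_dominated_convergence (K.indicator fun _ => C * M ^ 2)
    (fun n => hw.mul ((hu n).pow 2).aestronglyMeasurable) ?_ ?_ ?_
  · rw [integrable_indicator_iff hK.measurableSet]
    refine integrableOn_const ?_
    exact ((Measure.restrict_apply_le _ _).trans_lt hK.measure_lt_top).ne
  · intro n
    filter_upwards [hC] with x hx
    by_cases hxK : x ∈ K
    · rw [indicator_of_mem hxK, norm_mul, norm_pow]
      exact mul_le_mul (hx hxK) (pow_le_pow_left₀ (norm_nonneg _) (huM n x) 2) (by positivity)
        ((abs_nonneg _).trans (hx hxK))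
    · rw [indicator_of_notMem hxK, image_eq_zero_of_notMem_tsupport fun h => hxK (huK n h)]
      simp
  · filter_upwards [hlim] with x hx using (hx.pow 2).const_mul _

/-- The quadratic form of an admissible function, split into its gradient part and its potential
part. -/
lemma coneEnergy_eq_sub {v : RN N → ℝ} {g : RN N → RN N}
    (hg : MemLp g 2 (volume.restrict (coneDomain Ω ρ)))
    (hi : IntegrableOn (fun x => angular V x / ‖x‖ ^ 2 * v x ^ 2) (coneDomain Ω ρ)) :
    coneEnergy Ω V ρ v g = (∫ x in coneDomain Ω ρ, ‖g x‖ ^ 2) -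
      ∫ x in coneDomain Ω ρ, angular V x / ‖x‖ ^ 2 * v x ^ 2 :=
  integral_sub (hg.integrable_norm_pow (by simp)) hi

/-- The weighted integrals of `v²` are limits of those of the mollifications, by dominated
convergence. The gradient term stands on the larger side, so it suffices that mollifying does not
increase the Dirichlet integral; no strong `H¹` convergence is needed. -/
lemma improvedHardy (hN : 2 ≤ N) (hΩ : IsOpen Ω) (hρ : 1 ≤ ρ)
    (hV : MemLp V ⊤ ((surfaceMeasure N).restrict Ω)) (hlam : IsPrincipalEigenvalue Ω V lam) :
    ImprovedHardy Ω V ρ (hardyConst N + lam) (1 / 4) := by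
  intro v g h
  have hN1 : 1 ≤ N := by omega
  have hρ0 : 0 ≤ ρ := by linarith
  have hG := isOpen_coneDomain hΩ hρ0
  obtain ⟨K, M, u, hK, hKG, hvK, huc, huK, huM, hlim, hgrad⟩ := h.exists_smooth_approx hG
  have key := fun n => improvedHardy_of_smooth hN hΩ hρ hV hlam (huc n)
    (hK.of_isClosed_subset (isClosed_tsupport _) (huK n)) ((huK n).trans hKG)
  obtain ⟨mV, CV, bV⟩ := weights_bounded hN1 hΩ hρ hV hK hKG (Or.inl rfl)
  obtain ⟨mD, CD, bD⟩ := weights_bounded hN1 hΩ hρ hV hK hKG (Or.inr (Or.inl rfl))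
  obtain ⟨mL, CL, bL⟩ := weights_bounded hN1 hΩ hρ hV hK hKG (Or.inr (Or.inr rfl))
  have tV := tendsto_integral_weight hK mV bV (fun n => (huc n).continuous) huK huM hlim
  have tD := tendsto_integral_weight hK mD bD (fun n => (huc n).continuous) huK huM hlim
  have tL := tendsto_integral_weight hK mL bL (fun n => (huc n).continuous) huK huM hlim
  have hle := le_of_tendsto' (((tD.const_mul (hardyConst N + lam)).add (tL.const_mul (1 / 4))).add
    tV) fun n => (key n).trans (hgrad n)
  have hv2 : IntegrableOn (fun x => v x ^ 2) (coneDomain Ω ρ) := by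
    have := h.memLp.integrable_norm_pow (by simp)
    simpa [IntegrableOn] using this
  have hiV : IntegrableOn (fun x => angular V x / ‖x‖ ^ 2 * v x ^ 2) (coneDomain Ω ρ) := by
    refine integrable_mul_of_bounded_on mV bV hv2 ?_
    filter_upwards [hvK] with x hx hxK
    simp [hx hxK]
  rw [coneEnergy_eq_sub h.memLp_grad hiV]
  simp only [one_div_mul_eq_div] at hle
  linarith

/-- Smooth functions with compact support are admissible. -/
lemma isH1cLinfty_of_smooth {G : Set (RN N)} (hG : IsOpen G) {v : RN N → ℝ} (hv : ContDiff ℝ ∞ v)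
    (hc : HasCompactSupport v) (hs : tsupport v ⊆ G) : IsH1cLinfty G v (gradient v) := by
  have hv1 : ContDiff ℝ 1 v := hv.of_le (by simp)
  have hgc := continuous_gradient hv1
  refine ⟨(hv.continuous.memLp_of_hasCompactSupport hc).restrict _,
    (hgc.memLp_of_hasCompactSupport (hasCompactSupport_gradient hc)).restrict _, ?_,
    (hv.continuous.memLp_of_hasCompactSupport hc).restrict _, tsupport v, hc, hs, ?_⟩
  · intro φ hφ hφc hφs
    have hφ1 : ContDiff ℝ 1 φ := hφ.of_le (by simp)
    have hgφ := continuous_gradient hφ1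
    have i1 : Integrable fun x => v x • gradient φ x :=
      (hv.continuous.smul hgφ).integrable_of_hasCompactSupport hc.smul_right
    have i2 : Integrable fun x => φ x • gradient v x :=
      (hφ.continuous.smul hgc).integrable_of_hasCompactSupport hφc.smul_right
    rw [setIntegral_eq_integral_of_forall_compl_eq_zero fun x hx => ?_,
      setIntegral_eq_integral_of_forall_compl_eq_zero fun x hx => ?_]
    · refine ext_inner_left ℝ fun y => ?_
      rw [inner_neg_right, ← integral_inner i1, ← integral_inner i2]
      have hgr : ∀ (f : RN N → ℝ) x, ⟪y, gradient f x⟫ = fderiv ℝ f x y := fun f x => by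
        rw [real_inner_comm, inner_gradient_left]
      simp only [real_inner_smul_right, hgr]
      have e := integral_mul_fderiv_eq_neg_fderiv_mul_of_integrable (μ := volume) (𝕜 := ℝ)
        (f := v) (g := φ) (v := y) ?_ ?_ ?_ (fun x _ => hv1.differentiable (by simp) x)
        (fun x _ => hφ1.differentiable (by simp) x)
      · simp only [mul_comm (fderiv ℝ v _ y)] at e
        exact e
      · have := (hv1.continuous_fderiv_apply (by simp)).comp
          (continuous_id.prodMk (continuous_const (y := y)))
        exact (this.mul hφ.continuous).integrable_of_hasCompactSupport hφc.mul_left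
      · have := (hφ1.continuous_fderiv_apply (by simp)).comp
          (continuous_id.prodMk (continuous_const (y := y)))
        exact (hv.continuous.mul this).integrable_of_hasCompactSupport hc.mul_right
      · exact (hv.continuous.mul hφ.continuous).integrable_of_hasCompactSupport hc.mul_right
    · have : φ x = 0 := image_eq_zero_of_notMem_tsupport fun h => hx (hφs h)
      simp [this]
    · have : v x = 0 := image_eq_zero_of_notMem_tsupport fun h => hx (hs h)
      simp [this]
  · filter_upwards [ae_restrict_mem (hG.measurableSet.diff (isClosed_tsupport v).measurableSet)]
      with x hx using image_eq_zero_of_notMem_tsupport hx.2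

end General

/-! ### One-dimensional test functions -/

/-- The Emden–Fowler substitution: the function `r ↦ r^(-k) f (log r)` on `(0, ∞)`. -/
noncomputable def emdenFowler (k : ℝ) (f : ℝ → ℝ) (r : ℝ) : ℝ :=
  if 0 < r then Real.exp (-k * Real.log r) * f (Real.log r) else 0

section EmdenFowler

variable {k : ℝ} {f : ℝ → ℝ}

lemma emdenFowler_exp (t : ℝ) : emdenFowler k f (Real.exp t) = Real.exp (-k * t) * f t := by
  simp [emdenFowler, Real.exp_pos]

lemma emdenFowler_eventuallyEq {r : ℝ} (hr : 0 < r) :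
    emdenFowler k f =ᶠ[𝓝 r] fun r => Real.exp (-k * Real.log r) * f (Real.log r) := by
  filter_upwards [Ioi_mem_nhds hr] with x hx
  simp [emdenFowler, mem_Ioi.1 hx]

lemma tsupport_emdenFowler (hc : HasCompactSupport f) :
    tsupport (emdenFowler k f) ⊆ Real.exp '' tsupport f := by
  refine closure_minimal (fun r hr => ?_) (hc.isCompact.image Real.continuous_exp).isClosed
  have h0 : 0 < r := by
    by_contra h
    exact hr (by simp [emdenFowler, h])
  refine ⟨Real.log r, subset_tsupport f fun h => hr ?_, Real.exp_log h0⟩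
  simp [emdenFowler, h]

lemma hasCompactSupport_emdenFowler (hc : HasCompactSupport f) :
    HasCompactSupport (emdenFowler k f) :=
  (hc.isCompact.image Real.continuous_exp).of_isClosed_subset (isClosed_tsupport _)
    (tsupport_emdenFowler hc)

lemma contDiff_emdenFowler (hf : ContDiff ℝ ∞ f) (hc : HasCompactSupport f) :
    ContDiff ℝ ∞ (emdenFowler k f) := by
  refine contDiff_of_forall_mem_tsupport fun r hr => ?_
  obtain ⟨t, -, rfl⟩ := tsupport_emdenFowler hc hr
  have h0 := Real.exp_pos t
  have hl : ContDiffAt ℝ ∞ Real.log (Real.exp t) := Real.contDiffAt_log.2 h0.ne'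
  refine ContDiffAt.congr_of_eventuallyEq ?_ (emdenFowler_eventuallyEq h0)
  exact (Real.contDiff_exp.contDiffAt.comp _ (contDiffAt_const.mul hl)).mul
    (hf.contDiffAt.comp _ hl)

lemma deriv_emdenFowler_exp (hf : Differentiable ℝ f) (t : ℝ) :
    deriv (emdenFowler k f) (Real.exp t) =
      Real.exp (-k * t) * Real.exp (-t) * (deriv f t - k * f t) := by
  have h0 := Real.exp_pos t
  rw [(emdenFowler_eventuallyEq h0).deriv_eq]
  have hl := Real.hasDerivAt_log h0.ne'
  have h1 := (hl.const_mul (-k)).exp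
  have h2 : HasDerivAt f (deriv f t) (Real.log (Real.exp t)) := by
    rw [Real.log_exp]; exact (hf t).hasDerivAt
  have h3 := (h1.mul (h2.comp _ hl)).deriv
  refine Eq.trans h3 ?_
  simp only [Function.comp_apply, Real.log_exp, Real.exp_neg]
  ring

lemma integral_Ioi_zero_eq_exp (F : ℝ → ℝ) :
    ∫ r in Ioi (0 : ℝ), F r = ∫ t, Real.exp t * F (Real.exp t) := by
  have h := integral_image_eq_integral_abs_deriv_smul (s := univ) (f := Real.exp)
    (f' := Real.exp) MeasurableSet.univ (fun x _ => (Real.hasDerivAt_exp x).hasDerivWithinAt)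
    Real.exp_injective.injOn F
  rw [image_univ, Real.range_exp] at h
  rw [h, Measure.restrict_univ]
  simp only [abs_of_pos (Real.exp_pos _), smul_eq_mul]

/-- Under `r = e^t` all exponentials cancel against the weight `r^(2k+1)`, leaving `(f' - k f)² =
f'² + k² f² - k (f²)'`, whose last term integrates to zero. The weight is an abstract `m` so as to
cover both the natural power `r^(N-1)` and the constant `1`. -/
lemma integral_deriv_emdenFowler (hf : ContDiff ℝ ∞ f) (hc : HasCompactSupport f) {m : ℝ → ℝ}
    (hm : ∀ t, m (Real.exp t) = Real.exp ((2 * k + 1) * t)) :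
    ∫ r in Ioi (0 : ℝ), m r * deriv (emdenFowler k f) r ^ 2 =
      (∫ t, deriv f t ^ 2) + k ^ 2 * ∫ t, f t ^ 2 := by
  have hf1 : ContDiff ℝ 1 f := hf.of_le (by simp)
  have hd : Differentiable ℝ f := hf.differentiable (by simp)
  rw [integral_Ioi_zero_eq_exp]
  have e : ∀ t, Real.exp t * (m (Real.exp t) * deriv (emdenFowler k f) (Real.exp t) ^ 2) =
      deriv f t ^ 2 + k ^ 2 * f t ^ 2 - k * deriv (fun t => f t ^ 2) t := by
    intro t
    have h1 : deriv (fun t => f t ^ 2) t = 2 * f t * deriv f t := by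
      rw [((hd t).hasDerivAt.fun_pow 2).deriv]
      simp
    rw [deriv_emdenFowler_exp hd, hm, h1]
    have h2 : Real.exp t * Real.exp ((2 * k + 1) * t) * (Real.exp (-k * t) * Real.exp (-t)) ^ 2
        = 1 := by
      rw [← Real.exp_add, ← Real.exp_add, ← Real.exp_nat_mul, ← Real.exp_add, Real.exp_eq_one_iff]
      push_cast
      ring
    linear_combination (deriv f t - k * f t) ^ 2 * h2
  simp only [e]
  have i1 : Integrable fun t => deriv f t ^ 2 :=
    ((hf1.continuous_deriv le_rfl).pow 2).integrable_of_hasCompactSupport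
      (hc.deriv.mono fun x hx h0 => hx (by simp [h0]))
  have s2 : HasCompactSupport fun t => f t ^ 2 := hc.mono fun x hx h0 => hx (by simp [h0])
  have i2 : Integrable fun t => f t ^ 2 := (hf.continuous.pow 2).integrable_of_hasCompactSupport s2
  have i3 : Integrable (deriv fun t => f t ^ 2) :=
    ((hf1.pow 2).continuous_deriv le_rfl).integrable_of_hasCompactSupport s2.deriv
  have i12 : Integrable fun t => deriv f t ^ 2 + k ^ 2 * f t ^ 2 := i1.add (i2.const_mul _)
  rw [integral_sub i12 (i3.const_mul _), integral_add i1 (i2.const_mul _), integral_const_mul,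
    integral_const_mul, integral_deriv_of_hasCompactSupport (hf1.pow 2) s2]
  ring

/-- The Jacobian `e^t`, the weight `r^(2k+1)` and the factor `r^(-2k)` combine to `e^(2t)`, which
the Hardy weight `1 / r²` cancels exactly. -/
lemma integral_emdenFowler_sq {m w : ℝ → ℝ}
    (hm : ∀ t, m (Real.exp t) = Real.exp ((2 * k + 1) * t)) :
    ∫ r in Ioi (0 : ℝ), m r * (w r * emdenFowler k f r ^ 2) =
      ∫ t, Real.exp (2 * t) * w (Real.exp t) * f t ^ 2 := by
  rw [integral_Ioi_zero_eq_exp]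
  congr 1
  ext t
  rw [emdenFowler_exp, hm]
  have h2 : Real.exp t * Real.exp ((2 * k + 1) * t) * Real.exp (-k * t) ^ 2
      = Real.exp (2 * t) := by
    rw [← Real.exp_add, ← Real.exp_nat_mul, ← Real.exp_add]
    congr 1
    push_cast
    ring
  linear_combination (w (Real.exp t) * f t ^ 2) * h2

end EmdenFowler

/-- Wide bumps have small Dirichlet energy. -/
lemma exists_bump_small_energy (L : ℝ) {c : ℝ} (hc : 0 < c) :
    ∃ f : ℝ → ℝ, ContDiff ℝ ∞ f ∧ HasCompactSupport f ∧ tsupport f ⊆ Ioi L ∧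
      ∫ t, deriv f t ^ 2 < c * ∫ t, f t ^ 2 := by
  let χ : ContDiffBump (0 : ℝ) := ⟨1, 2, one_pos, one_lt_two⟩
  have hχ : ContDiff ℝ ∞ χ := χ.contDiff
  set A := ∫ t, deriv χ t ^ 2 with hA
  set B := ∫ t, χ t ^ 2 with hB
  have hB0 : 0 < B := by
    have hi : Integrable fun t => χ t ^ 2 :=
      (hχ.continuous.pow 2).integrable_of_hasCompactSupport
        (χ.hasCompactSupport.mono fun x hx h0 => hx (by simp [h0]))
    refine (hχ.continuous.pow 2).integral_pos_of_hasCompactSupport_nonneg_nonzero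
      (χ.hasCompactSupport.mono fun x hx h0 => hx (by simp [h0])) (fun t => sq_nonneg _)
      (x := 0) ?_
    have : χ 0 = 1 := χ.one_of_mem_closedBall (by simp [χ])
    simp [this]
  -- Stretching by `R` turns the energy `A` into `A / R` and the mass `B` into `R B`.
  obtain ⟨R, hR1, hR⟩ : ∃ R : ℝ, 1 ≤ R ∧ A < c * B * R ^ 2 := by
    refine ⟨|A| / (c * B) + 1, le_add_of_nonneg_left (by positivity), ?_⟩
    have h1 : c * B * (|A| / (c * B) + 1) = |A| + c * B := by field_simp
    have h2 : (1 : ℝ) ≤ |A| / (c * B) + 1 := le_add_of_nonneg_left (by positivity)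
    have h3 := le_abs_self A
    have h4 : 0 < c * B := by positivity
    nlinarith [abs_nonneg A]
  have hR0 : 0 < R := by linarith
  -- After the shift and the dilation the support starts no earlier than `R (a - 2) = R (|L| + 1)`,
  -- which exceeds `L` because `R ≥ 1`.
  set a : ℝ := |L| + 3 with ha
  set f : ℝ → ℝ := fun t => χ (t / R - a) with hf
  have hfc : ContDiff ℝ ∞ f := hχ.comp ((contDiff_id.div_const R).sub contDiff_const)
  have hsub : tsupport f ⊆ Icc (R * (a - 2)) (R * (a + 2)) := by
    refine closure_minimal (fun t ht => ?_) isClosed_Icc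
    have h1 : t / R - a ∈ Metric.ball (0 : ℝ) 2 := by
      have : t / R - a ∈ Function.support χ := ht
      rwa [χ.support_eq] at this
    rw [mem_ball_zero_iff, Real.norm_eq_abs, abs_lt] at h1
    constructor
    · have : a - 2 ≤ t / R := by linarith
      rw [le_div_iff₀ hR0] at this
      linarith
    · have : t / R ≤ a + 2 := by linarith
      rw [div_le_iff₀ hR0] at this
      linarith
  have hderiv : ∀ t, deriv f t = deriv χ (t / R - a) / R := by
    intro t
    have h1 := ((hχ.differentiable (by simp)) (t / R - a)).hasDerivAt
    have h2 : HasDerivAt (fun t : ℝ => t / R - a) (1 / R) t :=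
      ((hasDerivAt_id t).div_const R).sub_const a
    refine (h1.comp t h2).deriv.trans ?_
    ring
  have hscale : ∀ F : ℝ → ℝ, ∫ t, F (t / R - a) = R * ∫ t, F t := by
    intro F
    have h1 := Measure.integral_comp_div (fun t => F (t - a)) R
    rw [abs_of_pos hR0, smul_eq_mul, integral_sub_right_eq_self F a] at h1
    exact h1
  refine ⟨f, hfc, isCompact_Icc.of_isClosed_subset (isClosed_tsupport _) hsub, ?_, ?_⟩
  · intro t ht
    have h1 := (hsub ht).1
    have h2 := le_abs_self L
    have h3 := abs_nonneg L
    rw [mem_Ioi]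
    nlinarith
  · simp only [hderiv, div_pow]
    rw [integral_div, hscale fun t => deriv χ t ^ 2, hscale fun t => χ t ^ 2, ← hA, ← hB,
      div_lt_iff₀ (by positivity)]
    nlinarith

/-- The one-dimensional Hardy inequality `∫ f'² ≥ ∫ f² / (4t²)` has the optimal constant. -/
lemma exists_bump_hardy_violated (L : ℝ) {ε : ℝ} (hε : 1 / 4 < ε) :
    ∃ f : ℝ → ℝ, ContDiff ℝ ∞ f ∧ HasCompactSupport f ∧ tsupport f ⊆ Ioi L ∧
      ∫ t, deriv f t ^ 2 < ε * ∫ t, 1 / t ^ 2 * f t ^ 2 := by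
  -- Take `f(t) = t^(1/2) g(log t)`, that is `k = -1/2`, for which the weight `r^(2k+1)` is `1`.
  -- Then `∫ f'² = ∫ g'² + ¼ ∫ g²` and `∫ f²/t² = ∫ g²`, so a bump with `∫ g'² < (ε - 1/4) ∫ g²`
  -- suffices.
  obtain ⟨g, hg, hgc, hgL, hlt⟩ := exists_bump_small_energy (max L 0) (sub_pos.2 hε)
  have hm : ∀ t : ℝ, (fun _ => 1 : ℝ → ℝ) (Real.exp t) = Real.exp ((2 * (-1 / 2) + 1) * t) := by
    intro t
    norm_num
  have hsub : tsupport (emdenFowler (-1 / 2) g) ⊆ Ioi (max L 0) := by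
    refine (tsupport_emdenFowler hgc).trans ?_
    rintro _ ⟨t, ht, rfl⟩
    have h1 := mem_Ioi.1 (hgL ht)
    have h2 := Real.add_one_le_exp t
    rw [mem_Ioi]
    linarith
  refine ⟨emdenFowler (-1 / 2) g, contDiff_emdenFowler hg hgc, hasCompactSupport_emdenFowler hgc,
    hsub.trans (Ioi_subset_Ioi (le_max_left _ _)), ?_⟩
  have hzero : ∀ t ∉ Ioi (0 : ℝ), t ∉ tsupport (emdenFowler (-1 / 2) g) := fun t ht h =>
    ht (Ioi_subset_Ioi (le_max_right _ _) (hsub h))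
  have e1 := integral_deriv_emdenFowler (k := -1 / 2) (m := fun _ => 1) hg hgc hm
  have e2 := integral_emdenFowler_sq (k := -1 / 2) (m := fun _ => 1) (f := g) (w := fun t => 1 / t ^ 2) hm
  simp only [one_mul] at e1 e2
  rw [setIntegral_eq_integral_of_forall_compl_eq_zero fun t ht => by
    rw [image_eq_zero_of_notMem_tsupport fun h => hzero t ht (tsupport_deriv_subset h)]
    simp] at e1
  rw [setIntegral_eq_integral_of_forall_compl_eq_zero fun t ht => by
    simp [image_eq_zero_of_notMem_tsupport (hzero t ht)]] at e2
  rw [e1, e2]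
  have e3 : ∀ t : ℝ, Real.exp (2 * t) * (1 / Real.exp t ^ 2) * g t ^ 2 = g t ^ 2 := by
    intro t
    rw [← Real.exp_nat_mul, Nat.cast_two, mul_one_div_cancel (Real.exp_ne_zero _), one_mul]
  simp only [e3]
  linarith

/-! ### Optimality -/

section Optimality

variable {N : ℕ} {Ω : Set (USphere N)} {V : USphere N → ℝ} {ρ lam : ℝ}

/-- The product of a radial profile and an angular function. -/
noncomputable def radialProd {N : ℕ} (h : ℝ → ℝ) (ψ : USphere N → ℝ) (x : RN N) : ℝ :=
  h ‖x‖ * angular ψ x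

lemma radialProd_smul (h : ℝ → ℝ) (ψ : USphere N → ℝ) {r : ℝ} (hr : 0 < r) (s : USphere N) :
    radialProd h ψ (r • (s : RN N)) = h r * ψ s := by
  rw [radialProd, norm_smul_sphere hr.le, angular_smul ψ hr]

/-- The support lies in the polar image of a product of compact sets. This avoids the origin, the
only point where the norm or the angular extension may fail to be smooth. -/
lemma radialProd_admissible {h : ℝ → ℝ} {ψ : USphere N → ℝ} (hρ : 0 ≤ ρ) (hh : ContDiff ℝ ∞ h)
    (hc : HasCompactSupport h) (hs : tsupport h ⊆ Ioi ρ) (hψ : IsSphereTest Ω ψ) :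
    ContDiff ℝ ∞ (radialProd h ψ) ∧ HasCompactSupport (radialProd h ψ) ∧
      tsupport (radialProd h ψ) ⊆ coneDomain Ω ρ := by
  set K : Set (RN N) := polarMap '' (tsupport ψ ×ˢ tsupport h) with hK
  have hKc : IsCompact K :=
    ((isClosed_tsupport ψ).isCompact.prod hc).image continuous_polarMap
  have hsub : tsupport (radialProd h ψ) ⊆ K := by
    refine closure_minimal (fun x hx => ?_) hKc.isClosed
    have hx0 : x ≠ 0 := by
      rintro rfl
      exact hx (by simp [radialProd, angular])
    obtain ⟨s, hxs⟩ := exists_smul_sphere hx0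
    have hr : 0 < ‖x‖ := norm_pos_iff.2 hx0
    have hx' : h ‖x‖ * ψ s ≠ 0 := by
      rw [← radialProd_smul h ψ hr s, ← hxs]
      exact hx
    exact ⟨(s, ‖x‖), ⟨subset_tsupport _ (right_ne_zero_of_mul hx'),
      subset_tsupport _ (left_ne_zero_of_mul hx')⟩, hxs.symm⟩
  have hKG : K ⊆ coneDomain Ω ρ := by
    rintro _ ⟨⟨s, r⟩, ⟨h1, h2⟩, rfl⟩
    exact ⟨r, hs h2, s, hψ.2 h1, rfl⟩
  refine ⟨contDiff_of_forall_mem_tsupport fun x hx => ?_,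
    hKc.of_isClosed_subset (isClosed_tsupport _) hsub, hsub.trans hKG⟩
  have hx0 : x ≠ 0 :=
    norm_pos_iff.1 (hρ.trans_lt (lt_norm_of_mem_coneDomain hρ (hKG (hsub hx))))
  exact (hh.contDiffAt.comp x (contDiffAt_norm ℝ hx0)).mul (hψ.contDiffAt hx0)

lemma integral_cone_mul (hN : 1 ≤ N) (hΩ : IsOpen Ω) (hρ : 0 ≤ ρ) {f : RN N → ℝ}
    (hf : AEStronglyMeasurable f (volume.restrict (coneDomain Ω ρ))) {a : USphere N → ℝ}
    {b : ℝ → ℝ} (hab : ∀ (s : USphere N) (r : ℝ), ρ < r → f (r • (s : RN N)) = a s * b r) :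
    ∫ x in coneDomain Ω ρ, f x =
      (∫ s in Ω, a s ∂(surfaceMeasure N)) * ∫ r, b r ∂(radialMeasure N ρ) := by
  rw [integral_coneDomain hN hΩ hρ hf, ← integral_prod_mul]
  refine integral_congr_ae ?_
  filter_upwards [ae_polarMeasure_snd Ω ρ] with p hp using hab p.1 p.2 hp

/-- The improved Hardy inequality evaluated at products. -/
lemma ImprovedHardy.radialProd_le {μ ε : ℝ} (H : ImprovedHardy Ω V ρ μ ε) (hN : 2 ≤ N)
    (hΩ : IsOpen Ω) (hρ : 1 ≤ ρ) (hV : MemLp V ⊤ ((surfaceMeasure N).restrict Ω)) {h : ℝ → ℝ}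
    (hh : ContDiff ℝ ∞ h) (hc : HasCompactSupport h) (hs : tsupport h ⊆ Ioi ρ)
    {ψ : USphere N → ℝ} (hψ : IsSphereTest Ω ψ) :
    (∫ s in Ω, ψ s ^ 2 ∂(surfaceMeasure N)) *
      (μ * (∫ r, 1 / r ^ 2 * h r ^ 2 ∂(radialMeasure N ρ)) +
        ε * ∫ r, 1 / (r ^ 2 * Real.log r ^ 2) * h r ^ 2 ∂(radialMeasure N ρ)) ≤
    (∫ s in Ω, ψ s ^ 2 ∂(surfaceMeasure N)) * (∫ r, deriv h r ^ 2 ∂(radialMeasure N ρ)) +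
      sphereForm Ω V ψ * ∫ r, 1 / r ^ 2 * h r ^ 2 ∂(radialMeasure N ρ) := by
  have hN1 : 1 ≤ N := by omega
  have hρ0 : 0 ≤ ρ := by linarith
  have hG := isOpen_coneDomain hΩ hρ0
  obtain ⟨hv, hvc, hvs⟩ := radialProd_admissible hρ0 hh hc hs hψ
  set v := radialProd h ψ with hvdef
  have hd : Differentiable ℝ v := hv.differentiable (by simp)
  have hv1 : ContDiff ℝ 1 v := hv.of_le (by simp)
  have adm := isH1cLinfty_of_smooth hG hv hvc hvs
  have hv2 : IntegrableOn (fun x => v x ^ 2) (coneDomain Ω ρ) :=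
    ((hv.continuous.pow 2).integrable_of_hasCompactSupport
      (hvc.mono fun x hx h0 => hx (by simp [h0]))).integrableOn
  obtain ⟨mV, CV, bV⟩ := weights_bounded hN1 hΩ hρ hV hvc hvs (Or.inl rfl)
  obtain ⟨mD, -⟩ := weights_bounded hN1 hΩ hρ hV hvc hvs (Or.inr (Or.inl rfl))
  obtain ⟨mL, -⟩ := weights_bounded hN1 hΩ hρ hV hvc hvs (Or.inr (Or.inr rfl))
  have iV : IntegrableOn (fun x => angular V x / ‖x‖ ^ 2 * v x ^ 2) (coneDomain Ω ρ) :=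
    integrable_mul_of_bounded_on mV bV hv2
      (.of_forall fun x hx => by simp [image_eq_zero_of_notMem_tsupport hx])
  have iG : IntegrableOn (fun x => ‖gradient v x‖ ^ 2) (coneDomain Ω ρ) :=
    (integrable_gradient_sq hv1 hvc).integrableOn
  have iR : IntegrableOn (radialPart v) (coneDomain Ω ρ) :=
    (integrable_radialPart hv1 hvc).integrableOn
  have hpos : ∀ {r}, ρ < r → 0 < r := fun hr => hρ0.trans_lt hr
  have hvr : ∀ (s : USphere N) {r : ℝ}, ρ < r → v (r • (s : RN N)) = h r * ψ s :=
    fun s _ hr => radialProd_smul h ψ (hpos hr) s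
  have eR : ∫ x in coneDomain Ω ρ, radialPart v x = (∫ s in Ω, ψ s ^ 2 ∂(surfaceMeasure N)) *
      ∫ r, deriv h r ^ 2 ∂(radialMeasure N ρ) := by
    refine integral_cone_mul hN1 hΩ hρ0 iR.1 fun s r hr => ?_
    have hev : (fun r : ℝ => v (r • (s : RN N))) =ᶠ[𝓝 r] fun r => h r * ψ s := by
      filter_upwards [Ioi_mem_nhds (hpos hr)] with r' hr' using radialProd_smul h ψ hr' s
    rw [radialPart_smul (hpos hr) (hd _), hev.deriv_eq, deriv_mul_const_field]
    ring
  have eT : ∫ x in coneDomain Ω ρ, (‖gradient v x‖ ^ 2 - radialPart v x) =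
      (∫ s in Ω, ‖sphereGrad ψ s‖ ^ 2 ∂(surfaceMeasure N)) *
      ∫ r, 1 / r ^ 2 * h r ^ 2 ∂(radialMeasure N ρ) := by
    refine integral_cone_mul hN1 hΩ hρ0 (iG.1.sub iR.1) fun s r hr => ?_
    have hsl : (fun s : USphere N => v (r • (s : RN N))) = fun s => h r * ψ s := by
      ext s
      exact hvr s hr
    simp only [Pi.sub_apply]
    rw [gradient_sub_radialPart_smul (hpos hr) (hd _), hsl, hψ.sphereGrad_const_mul, norm_smul, mul_pow,
      Real.norm_eq_abs, sq_abs]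
    ring
  have eV : ∫ x in coneDomain Ω ρ, angular V x / ‖x‖ ^ 2 * v x ^ 2 =
      (∫ s in Ω, V s * ψ s ^ 2 ∂(surfaceMeasure N)) *
      ∫ r, 1 / r ^ 2 * h r ^ 2 ∂(radialMeasure N ρ) := by
    refine integral_cone_mul hN1 hΩ hρ0 iV.1 fun s r hr => ?_
    rw [hvr s hr, angular_smul V (hpos hr), norm_smul_sphere (hpos hr).le]
    ring
  have eD : ∫ x in coneDomain Ω ρ, 1 / ‖x‖ ^ 2 * v x ^ 2 =
      (∫ s in Ω, ψ s ^ 2 ∂(surfaceMeasure N)) *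
      ∫ r, 1 / r ^ 2 * h r ^ 2 ∂(radialMeasure N ρ) := by
    refine integral_cone_mul hN1 hΩ hρ0 (mD.mul hv2.1) fun s r hr => ?_
    simp only [Pi.mul_apply]
    rw [hvr s hr, norm_smul_sphere (hpos hr).le]
    ring
  have eL : ∫ x in coneDomain Ω ρ, 1 / (‖x‖ ^ 2 * Real.log ‖x‖ ^ 2) * v x ^ 2 =
      (∫ s in Ω, ψ s ^ 2 ∂(surfaceMeasure N)) *
      ∫ r, 1 / (r ^ 2 * Real.log r ^ 2) * h r ^ 2 ∂(radialMeasure N ρ) := by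
    refine integral_cone_mul hN1 hΩ hρ0 (mL.mul hv2.1) fun s r hr => ?_
    simp only [Pi.mul_apply]
    rw [hvr s hr, norm_smul_sphere (hpos hr).le]
    ring
  have key := H v (gradient v) adm
  rw [coneEnergy_eq_sub adm.memLp_grad iV] at key
  simp only [one_div_mul_eq_div] at key eD eL eT eV ⊢
  rw [integral_sub iG iR] at eT
  rw [eV, eD, eL] at key
  rw [sphereForm, integral_sub hψ.integrable_grad_sq (hψ.integrable_potential hV)]
  linarith

/-- Reduction of the improved Hardy inequality to dimension one. -/
lemma ImprovedHardy.radial_le {μ ε : ℝ} (H : ImprovedHardy Ω V ρ μ ε) (hN : 2 ≤ N)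
    (hΩ : IsOpen Ω) (hΩn : Ω.Nonempty) (hρ : 1 ≤ ρ)
    (hV : MemLp V ⊤ ((surfaceMeasure N).restrict Ω)) (hlam : IsPrincipalEigenvalue Ω V lam)
    {h : ℝ → ℝ} (hh : ContDiff ℝ ∞ h) (hc : HasCompactSupport h) (hs : tsupport h ⊆ Ioi ρ) :
    μ * (∫ r, 1 / r ^ 2 * h r ^ 2 ∂(radialMeasure N ρ)) +
      ε * (∫ r, 1 / (r ^ 2 * Real.log r ^ 2) * h r ^ 2 ∂(radialMeasure N ρ)) ≤
    (∫ r, deriv h r ^ 2 ∂(radialMeasure N ρ)) +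
      lam * ∫ r, 1 / r ^ 2 * h r ^ 2 ∂(radialMeasure N ρ) := by
  -- The eigenfunction itself need not be a test function, so its approximants are inserted; in the
  -- limit every term carries the factor `Q > 0`, which cancels.
  obtain ⟨ψ, Q, hQ, hψ, h1, h2⟩ := hlam.exists_approx hΩ hΩn hV
  have key := le_of_tendsto_of_tendsto' (h1.mul_const _) ((h1.mul_const _).add (h2.mul_const _))
    fun n => H.radialProd_le hN hΩ hρ hV hh hc hs (hψ n)
  refine le_of_mul_le_mul_left (key.trans_eq ?_) hQ
  ring

/-- The one-dimensional inequality in the logarithmic variable. -/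
lemma ImprovedHardy.log_le {μ ε : ℝ} (H : ImprovedHardy Ω V ρ μ ε) (hN : 2 ≤ N)
    (hΩ : IsOpen Ω) (hΩn : Ω.Nonempty) (hρ : 1 ≤ ρ)
    (hV : MemLp V ⊤ ((surfaceMeasure N).restrict Ω)) (hlam : IsPrincipalEigenvalue Ω V lam)
    {f : ℝ → ℝ} (hf : ContDiff ℝ ∞ f) (hc : HasCompactSupport f)
    (hs : tsupport f ⊆ Ioi (Real.log ρ)) :
    (μ - (hardyConst N + lam)) * (∫ t, f t ^ 2) + ε * (∫ t, 1 / t ^ 2 * f t ^ 2) ≤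
      ∫ t, deriv f t ^ 2 := by
  have hρ0 : 0 < ρ := by linarith
  -- With this exponent `2k + 1 = N - 1` matches the radial density, and `k²` is the Hardy constant.
  set k : ℝ := ((N : ℝ) - 2) / 2 with hk
  have hsub : tsupport (emdenFowler k f) ⊆ Ioi ρ := by
    refine (tsupport_emdenFowler hc).trans ?_
    rintro _ ⟨t, ht, rfl⟩
    exact (Real.log_lt_iff_lt_exp hρ0).1 (hs ht)
  have key := H.radial_le hN hΩ hΩn hρ hV hlam (contDiff_emdenFowler (k := k) hf hc)
    (hasCompactSupport_emdenFowler hc) hsub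
  have hm : ∀ t : ℝ, (fun r : ℝ => r ^ (N - 1)) (Real.exp t) = Real.exp ((2 * k + 1) * t) := by
    intro t
    simp only
    rw [← Real.exp_nat_mul, Nat.cast_sub (by omega : 1 ≤ N), hk]
    congr 1
    push_cast
    ring
  -- The integrands vanish off the support, so `(ρ, ∞)` may be enlarged to `(0, ∞)`, the range of
  -- `exp`.
  have conv : ∀ F : ℝ → ℝ, (∀ r, emdenFowler k f r = 0 → deriv (emdenFowler k f) r = 0 → F r = 0) →
      ∫ r, F r ∂(radialMeasure N ρ) = ∫ r in Ioi (0 : ℝ), r ^ (N - 1) * F r := by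
    intro F hF
    rw [integral_radialMeasure N hρ0.le]
    refine (setIntegral_eq_of_subset_of_forall_sdiff_eq_zero measurableSet_Ioi
      (Ioi_subset_Ioi hρ0.le) fun r hr => ?_).symm
    have hr' : r ∉ tsupport (emdenFowler k f) := fun h' => hr.2 (hsub h')
    rw [hF r (image_eq_zero_of_notMem_tsupport hr')
      (image_eq_zero_of_notMem_tsupport fun h' => hr' (tsupport_deriv_subset h')), mul_zero]
  rw [conv _ fun r h1 _ => by simp [h1], conv _ fun r h1 _ => by simp [h1],
    conv _ fun r _ h2 => by simp [h2],
    integral_deriv_emdenFowler (k := k) (m := fun r => r ^ (N - 1)) hf hc hm,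
    integral_emdenFowler_sq (k := k) (m := fun r => r ^ (N - 1)) (f := f)
      (w := fun r => 1 / r ^ 2) hm,
    integral_emdenFowler_sq (k := k) (m := fun r => r ^ (N - 1)) (f := f)
      (w := fun r => 1 / (r ^ 2 * Real.log r ^ 2)) hm] at key
  have e1 : ∀ t : ℝ, Real.exp (2 * t) * (1 / Real.exp t ^ 2) * f t ^ 2 = f t ^ 2 := by
    intro t
    rw [← Real.exp_nat_mul, Nat.cast_two, mul_one_div_cancel (Real.exp_ne_zero _), one_mul]
  have e2 : ∀ t : ℝ, Real.exp (2 * t) * (1 / (Real.exp t ^ 2 * Real.log (Real.exp t) ^ 2)) *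
      f t ^ 2 = 1 / t ^ 2 * f t ^ 2 := by
    intro t
    rw [← Real.exp_nat_mul, Nat.cast_two, Real.log_exp, ← one_div_mul_one_div, ← mul_assoc,
      mul_one_div_cancel (Real.exp_ne_zero _), one_mul]
  simp only [e1, e2] at key
  have hH : hardyConst N = k ^ 2 := rfl
  rw [hH]
  linarith

end Optimality

/-! ### Conclusion -/

theorem theorem3p1 (N : ℕ) (hN : 2 ≤ N) (Ω : Set (USphere N)) (hΩ : IsOpen Ω)
    (hΩc : IsConnected Ω) (V : USphere N → ℝ)
    (hV : MemLp V ⊤ ((surfaceMeasure N).restrict Ω)) (ρ : ℝ) (hρ : 1 ≤ ρ)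
    (lam : ℝ) (hlam : IsPrincipalEigenvalue Ω V lam) :
    ImprovedHardy Ω V ρ (hardyConst N + lam) (1 / 4) ∧
    (∀ ε : ℝ, 1 / 4 < ε → ¬ ImprovedHardy Ω V ρ (hardyConst N + lam) ε) ∧
    (∀ μ : ℝ, hardyConst N + lam < μ → ∀ ε : ℝ, ¬ ImprovedHardy Ω V ρ μ ε) := by
  refine ⟨improvedHardy hN hΩ hρ hV hlam, fun ε hε H => ?_, fun μ hμ ε H => ?_⟩
  · obtain ⟨f, hf, hc, hs, hlt⟩ := exists_bump_hardy_violated (Real.log ρ) hε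
    have := H.log_le hN hΩ hΩc.nonempty hρ hV hlam hf hc hs
    rw [sub_self, zero_mul, zero_add] at this
    exact this.not_gt hlt
  · set δ := μ - (hardyConst N + lam) with hδ
    have hδ0 : 0 < δ := sub_pos.2 hμ
    -- Beyond `T` the `ε` term is harmless: `T ≥ 1` and `T ≥ 2|ε|/δ` give `|ε| / t² ≤ δ / 2` for `t
    -- > T`.
    set T : ℝ := |Real.log ρ| + 2 * |ε| / δ + 1 with hT
    have hT1 : 1 ≤ T := le_add_of_nonneg_left (by positivity)
    have hTρ : Real.log ρ ≤ T := by
      have h1 := le_abs_self (Real.log ρ)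
      have h2 : 0 ≤ 2 * |ε| / δ := by positivity
      linarith
    have hTε : |ε| ≤ δ / 2 * T ^ 2 := by
      have h1 : 2 * |ε| / δ ≤ T := by
        have := abs_nonneg (Real.log ρ)
        linarith
      rw [div_le_iff₀ hδ0] at h1
      have h2 : δ * T ≤ δ * T ^ 2 :=
        mul_le_mul_of_nonneg_left (le_self_pow₀ hT1 two_ne_zero) hδ0.le
      linarith
    -- The inequality would force `∫ f'² ≥ δ ∫ f² - (δ/2) ∫ f²`, while this bump has energy below
    -- `(δ/2) ∫ f²`.
    obtain ⟨f, hf, hc, hs, hlt⟩ := exists_bump_small_energy T (half_pos hδ0)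
    have key := H.log_le hN hΩ hΩc.nonempty hρ hV hlam hf hc (hs.trans (Ioi_subset_Ioi hTρ))
    have i2 : Integrable fun t => f t ^ 2 :=
      (hf.continuous.pow 2).integrable_of_hasCompactSupport
        (hc.mono fun x hx h0 => hx (by simp [h0]))
    have hbound : ∀ t, ‖ε * (1 / t ^ 2 * f t ^ 2)‖ ≤ δ / 2 * f t ^ 2 := by
      intro t
      by_cases ht : t ∈ tsupport f
      · have h1 : T < t := hs ht
        have h2 : |ε| ≤ δ / 2 * t ^ 2 :=
          hTε.trans (mul_le_mul_of_nonneg_left (by nlinarith) (by positivity))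
        have h3 : 0 < t := by linarith
        rw [norm_mul, Real.norm_eq_abs, Real.norm_of_nonneg (by positivity), ← mul_assoc,
          mul_one_div]
        exact mul_le_mul_of_nonneg_right ((div_le_iff₀ (by positivity)).2 h2) (sq_nonneg _)
      · simp [image_eq_zero_of_notMem_tsupport ht]
    have h4 := norm_integral_le_of_norm_le (i2.const_mul (δ / 2)) (.of_forall hbound)
    rw [integral_const_mul, integral_const_mul, Real.norm_eq_abs] at h4
    have h5 := neg_abs_le (ε * ∫ t, 1 / t ^ 2 * f t ^ 2)
    linarith
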